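/- Let $p$ be an odd prime and let $K$ be a CM number field which is Galois over $\mathbb{Q}$, contains the $p$-th roots of unity, and is such that every prime of $K$ above $p$ is totally ramified in the cyclotomic $\mathbb{Z}_p$-extension $K_\infty/K$ and every prime above $p$ of the maximal real subfield $K^+$ splits in $K/K^+$. Put $\Delta=\mathrm{Gal}(K/\mathbb{Q})$, $\Delta^+=\mathrm{Gal}(K^+/\mathbb{Q})$, let $j$ be complex conjugation, and let $K_n=K(\mu_{p^n})$ be the intermediate fields of $K_\infty/K$. Let $A_n$ be the $p$-part of the ideal class group of $K_n$, $B_n\subset A_n$ the subgroup generated by the ($p$-parts of the) classes of the primes above $p$, and let $A=\varprojlim_n A_n$ and $B=\varprojlim_n B_n\subset A$ be the projective limits under the norm maps, with $B^-=(1-j)B$. Fix a prime $\wp$ of $K$ above $p$, let $\wp_n$ be the prime of $K_n$ above $\wp$, and let $b=(b_n)_n$, where $b_n\in A_n$ is (the $p$-part of) the class of $\wp_n^{1-j}$. Let $D(\wp^+)\subset\Delta^+$ be the decomposition group of $\wp^+=\wp\cap K^+$ and let $C^+\subset\Delta$ be a set of elements whose restrictions to $K^+$ form a system of representatives of the cosets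 $\Delta^+/D(\wp^+)$. Then the Galois action on ideal classes induces an action of $\Delta$ on $B^-$ (any lift of $\nu\in\Delta$ acts in the same way), $b\in B^-$, and the elements $\nu b$, $\nu\in C^+$, span $B^-$ over $\mathbb{Z}_p$ and are linearly independent over $\mathbb{Z}_p$. Moreover $B^-=\mathbb{Z}_p[\Delta]\,b$ is a cyclic $\mathbb{Z}_p[\Delta]$-module, and it is free over $\mathbb{Z}_p$ of rank $s=|C^+|$, which is the number of pairs of conjugate primes of $K$ above $p$. -/

import Mathlib

open NumberField IsDedekindDomain
open scoped TensorProduct Pointwise nonZeroDivisors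

noncomputable section

namespace GrossKuzmin

/-! ### `p`-parts of finite abelian groups -/

/-- The `p`-part of a (finite) commutative group `G`, written additively, with its `ℤ_p`-module
structure: `ℤ_p ⊗ G`. For finite `G` this is the `p`-primary component of `G`
(see `pPart_bijective`), and `x ↦ 1 ⊗ x` is the projection of `G` onto that component. -/
abbrev PPart (p : ℕ) [Fact p.Prime] (G : Type*) [CommGroup G] : Type _ :=
  ℤ_[p] ⊗[ℤ] Additive G

/-- The image of `x : G` in the `p`-part of `G`. -/
def toPPart (p : ℕ) [Fact p.Prime] {G : Type*} [CommGroup G] (x : G) : PPart p G :=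
  1 ⊗ₜ[ℤ] Additive.ofMul x

/-- The `ℤ_p`-linear map induced on `p`-parts by a homomorphism. -/
def PPart.map (p : ℕ) [Fact p.Prime] {G H : Type*} [CommGroup G] [CommGroup H] (f : G →* H) :
    PPart p G →ₗ[ℤ_[p]] PPart p H :=
  (MonoidHom.toAdditive f).toIntLinearMap.baseChange ℤ_[p]

/-- For a finite group the `p`-primary component maps bijectively onto `ℤ_p ⊗ G`. -/
theorem pPart_bijective (p : ℕ) [Fact p.Prime] (G : Type*) [CommGroup G] [Finite G] :
    Function.Bijective
      (fun x : CommGroup.primaryComponent G p => (toPPart p (x : G) : PPart p G)) := by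
  have hpp : p.Prime := Fact.out
  obtain ⟨k, m, hm, hN⟩ := Nat.exists_eq_pow_mul_and_not_dvd (n := Nat.card G)
    Nat.card_pos.ne' p hpp.ne_one
  have hcop : Nat.Coprime m (p ^ k) := ((hpp.coprime_iff_not_dvd.2 hm).symm).pow_right k
  have hkill : ∀ g : G, (g ^ p ^ k) ^ m = 1 := fun g => by
    rw [← pow_mul, ← hN]; exact pow_card_eq_one'
  -- elements of `p`-power order are killed by `p ^ k`
  have hord : ∀ (g : G) (i : ℕ), g ^ p ^ i = 1 → g ^ p ^ k = 1 := fun g i hg => by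
    have h1 : orderOf g ∣ p ^ i := orderOf_dvd_of_pow_eq_one hg
    have h2 : orderOf g ∣ p ^ k * m := hN ▸ orderOf_dvd_natCard g
    have h3 : Nat.Coprime (orderOf g) m :=
      Nat.Coprime.coprime_dvd_left h1 (((hpp.coprime_iff_not_dvd.2 hm)).pow_left i)
    exact orderOf_dvd_iff_pow_eq_one.1 (h3.dvd_of_dvd_mul_right h2)
  have hone : (toPPart p (1 : G)) = 0 := TensorProduct.tmul_zero _ _
  have hmul : ∀ g h : G, toPPart p (g * h) = toPPart p g + toPPart p h :=
    fun g h => TensorProduct.tmul_add _ _ _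
  have hpow : ∀ (g : G) (n : ℕ), toPPart p (g ^ n) = n • toPPart p g := fun g n => by
    induction n with
    | zero => simp [hone]
    | succ n ih => rw [pow_succ, hmul, ih, succ_nsmul]
  -- `1 ⊗ g ^ (p ^ k) = 0`
  have hz : ∀ g : G, toPPart p (g ^ p ^ k) = 0 := fun g => by
    have hu : IsUnit (m : ℤ_[p]) := by
      rw [PadicInt.isUnit_iff, PadicInt.norm_natCast_eq_one_iff]
      exact hpp.coprime_iff_not_dvd.2 hm
    have h0 : (m : ℤ_[p]) • toPPart p (g ^ p ^ k) = 0 := by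
      rw [Nat.cast_smul_eq_nsmul, ← hpow, hkill, hone]
    exact (hu.smul_eq_zero).1 h0
  constructor
  · intro x y hxy
    have hxy' : toPPart p ((x / y : CommGroup.primaryComponent G p) : G) = 0 := by
      have := hmul (x / y : CommGroup.primaryComponent G p) (y : G)
      rw [← Subgroup.coe_mul, div_mul_cancel] at this
      simpa [this] using hxy
    rw [← div_eq_one]
    generalize x / y = w at hxy'
    let q : ℤ_[p] →ₗ[ℤ] (ℤ ⧸ Ideal.span {((p ^ k : ℕ) : ℤ)}) :=
      (((Int.quotientSpanNatEquivZMod (p ^ k)).symm.toRingHom.comp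
        (PadicInt.toZModPow k)).toAddMonoidHom).toIntLinearMap
    have h1 := congrArg (TensorProduct.quotTensorEquivQuotSMul (Additive G)
      (Ideal.span {((p ^ k : ℕ) : ℤ)})) (congrArg (q.rTensor (Additive G)) hxy')
    have hq : q 1 = Ideal.Quotient.mk _ 1 := by simp [q]
    rw [toPPart, LinearMap.rTensor_tmul, hq, map_zero, map_zero,
      TensorProduct.quotTensorEquivQuotSMul_mk_tmul, one_smul,
      Submodule.Quotient.mk_eq_zero, Submodule.ideal_span_singleton_smul] at h1
    obtain ⟨v, -, hv⟩ := h1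
    have hv' : (Additive.toMul v) ^ p ^ k = (w : G) := by
      rw [← zpow_natCast]
      exact congrArg Additive.toMul hv
    obtain ⟨i, hi⟩ := w.2
    have : (Additive.toMul v) ^ p ^ (k + i) = 1 := by
      rw [pow_add, pow_mul, hv', hi]
    have := hord _ _ this
    rw [hv'] at this
    exact Subtype.ext this
  · intro t
    induction t using TensorProduct.induction_on with
    | zero => exact ⟨1, hone⟩
    | add a b ha hb =>
      obtain ⟨x, rfl⟩ := ha
      obtain ⟨y, rfl⟩ := hb
      exact ⟨x * y, hmul _ _⟩
    | tmul z g =>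
      obtain ⟨w, hw⟩ := Ideal.mem_span_singleton.1 (PadicInt.appr_spec k z)
      obtain ⟨c, hc1, hc2⟩ : ∃ c : ℕ, c ≡ 0 [MOD m] ∧ c ≡ 1 [MOD p ^ k] :=
        ⟨_, (Nat.chineseRemainder hcop 0 1).2⟩
      have h1 : z ⊗ₜ[ℤ] g = toPPart p (Additive.toMul g ^ z.appr k) := by
        have e : z = (z.appr k : ℤ_[p]) + w * (p ^ k : ℕ) := by
          rw [Nat.cast_pow, mul_comm, ← hw]; ring
        have e2 : z ⊗ₜ[ℤ] g = z • toPPart p (Additive.toMul g) := by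
          simp [toPPart, TensorProduct.smul_tmul']
        rw [e2]
        conv_lhs => rw [e]
        rw [add_smul, mul_smul, Nat.cast_smul_eq_nsmul, Nat.cast_smul_eq_nsmul, ← hpow, ← hpow, hz,
          smul_zero, add_zero]
      generalize Additive.toMul g ^ z.appr k = h at h1
      refine ⟨⟨h ^ c, ?_⟩, ?_⟩
      · have : (h ^ c) ^ p ^ k = 1 := by
          obtain ⟨d, rfl⟩ := (Nat.modEq_zero_iff_dvd.1 hc1)
          rw [← pow_mul, mul_right_comm, mul_comm m, pow_mul, pow_mul, hkill, one_pow]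
        exact ⟨k, this⟩
      · rw [h1]
        change toPPart p (h ^ c) = toPPart p h
        have hk0 : ∀ d : ℕ, toPPart p (h ^ (p ^ k * d)) = 0 := fun d => by
          rw [pow_mul, hpow, hz, smul_zero]
        have key : ∀ a b : ℕ, a ≡ b [MOD p ^ k] → a ≤ b → toPPart p (h ^ a) = toPPart p (h ^ b) := by
          intro a b hab hle
          obtain ⟨d, hd⟩ := (Nat.modEq_iff_dvd' hle).1 hab
          obtain rfl : b = a + p ^ k * d := by omega
          rw [pow_add, hmul, hk0, add_zero]
        rcases le_total c 1 with hle | hle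
        · simpa using key c 1 hc2 hle
        · simpa using (key 1 c hc2.symm hle).symm

/-! ### The norm map on ideal classes -/

section ClassNorm

variable (F E : Type*) [Field F] [NumberField F] [Field E] [NumberField E] [Algebra F E]

/-- The relative norm of nonzero ideals. -/
def idealNorm (I : (Ideal (𝓞 E))⁰) : (Ideal (𝓞 F))⁰ :=
  ⟨Ideal.relNorm (𝓞 F) (I : Ideal (𝓞 E)), mem_nonZeroDivisors_iff_ne_zero.2 fun h =>
    mem_nonZeroDivisors_iff_ne_zero.1 I.2 (Ideal.relNorm_eq_bot_iff.1 h)⟩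

theorem mk0_idealNorm_eq {I J : (Ideal (𝓞 E))⁰} (h : ClassGroup.mk0 I = ClassGroup.mk0 J) :
    ClassGroup.mk0 (idealNorm F E I) = ClassGroup.mk0 (idealNorm F E J) := by
  obtain ⟨x, y, hx, hy, hxy⟩ := ClassGroup.mk0_eq_mk0_iff.1 h
  refine ClassGroup.mk0_eq_mk0_iff.2 ⟨Algebra.intNorm (𝓞 F) (𝓞 E) x,
    Algebra.intNorm (𝓞 F) (𝓞 E) y, ?_, ?_, ?_⟩
  · simpa using hx
  · simpa using hy
  · have := congrArg (Ideal.relNorm (𝓞 F)) hxy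
    rw [map_mul, map_mul, Ideal.relNorm_singleton, Ideal.relNorm_singleton] at this
    exact this

/-- The norm map `Cl(E) → Cl(F)`, sending the class of `I` to the class of its relative norm
(see `classNorm_mk0`). -/
def classNorm : ClassGroup (𝓞 E) →* ClassGroup (𝓞 F) :=
  MonoidHom.mk' (fun c => ClassGroup.mk0 (idealNorm F E (ClassGroup.mk0_surjective c).choose)) <| by
    intro c d
    have hc := (ClassGroup.mk0_surjective c).choose_spec
    have hd := (ClassGroup.mk0_surjective d).choose_spec
    have hcd := (ClassGroup.mk0_surjective (c * d)).choose_spec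
    rw [← map_mul]
    have : idealNorm F E (ClassGroup.mk0_surjective c).choose *
        idealNorm F E (ClassGroup.mk0_surjective d).choose =
        idealNorm F E ((ClassGroup.mk0_surjective c).choose *
          (ClassGroup.mk0_surjective d).choose) := by
      ext1
      simp [idealNorm]
    rw [this]
    apply mk0_idealNorm_eq
    rw [hcd, map_mul, hc, hd]

theorem classNorm_mk0 (I : (Ideal (𝓞 E))⁰) :
    classNorm F E (ClassGroup.mk0 I) = ClassGroup.mk0 (idealNorm F E I) :=
  mk0_idealNorm_eq F E (ClassGroup.mk0_surjective (ClassGroup.mk0 I)).choose_spec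

end ClassNorm

/-! ### The cyclotomic `ℤ_p`-extension -/

section Tower

variable (p : ℕ) (K : Type*) [Field K]

/-- The field `K_n = K(μ_{p^n})`. If `K` is a number field containing `μ_p`, `p` odd, and
`μ_{p^k} ⊂ K`, `μ_{p^{k+1}} ⊄ K`, these are the intermediate fields of the cyclotomic
`ℤ_p`-extension of `K`, numbered so that `K_n = K` for `n ≤ k` and `[K_n : K] = p^{n-k}` for
`n ≥ k`. -/
def layer (n : ℕ) : IntermediateField K (AlgebraicClosure K) :=
  IntermediateField.adjoin K {z : AlgebraicClosure K | z ^ p ^ n = 1}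

theorem layer_mono {n m : ℕ} (h : n ≤ m) : layer p K n ≤ layer p K m := by
  refine IntermediateField.adjoin.mono K _ _ fun z (hz : z ^ p ^ n = 1) => ?_
  obtain ⟨d, rfl⟩ := Nat.exists_eq_add_of_le h
  change z ^ p ^ (n + d) = 1
  rw [pow_add, pow_mul, hz, one_pow]

instance layer_numberField [hp : Fact p.Prime] [NumberField K] (n : ℕ) :
    NumberField (layer p K n) := by
  have hfin : {z : AlgebraicClosure K | z ^ p ^ n = 1}.Finite := by
    have hpos : 0 < p ^ n := pow_pos hp.out.pos n
    refine (Polynomial.nthRootsFinset (p ^ n) (1 : AlgebraicClosure K)).finite_toSet.subset ?_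
    intro z hz
    simpa [Polynomial.mem_nthRootsFinset hpos] using hz
  have := hfin.to_subtype
  have : FiniteDimensional K (layer p K n) :=
    IntermediateField.finiteDimensional_adjoin fun x _ => Algebra.IsIntegral.isIntegral x
  exact NumberField.of_module_finite K (layer p K n)

variable [NumberField K]

theorem apply_mem_layer [IsGalois ℚ K] (g : Gal(AlgebraicClosure K/ℚ)) {n : ℕ}
    {x : AlgebraicClosure K} (hx : x ∈ layer p K n) : g x ∈ layer p K n := by
  induction hx using IntermediateField.adjoin_induction with
  | mem x hx =>
    apply IntermediateField.subset_adjoin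
    change g x ^ p ^ n = 1
    rw [← map_pow, hx, map_one]
  | algebraMap x =>
    rw [← AlgEquiv.restrictNormal_commutes]
    exact IntermediateField.algebraMap_mem _ _
  | add x y _ _ hx hy => rw [map_add]; exact add_mem hx hy
  | inv x _ hx => rw [map_inv₀]; exact inv_mem hx
  | mul x y _ _ hx hy => rw [map_mul]; exact mul_mem hx hy

/-- The automorphism of `K_n` obtained by restricting an automorphism of the algebraic closure
(`K_n/ℚ` is normal because `K/ℚ` is). -/
def layerAut [IsGalois ℚ K] (n : ℕ) (g : Gal(AlgebraicClosure K/ℚ)) :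
    layer p K n ≃+* layer p K n where
  toFun x := ⟨g x, apply_mem_layer p K g x.2⟩
  invFun x := ⟨g.symm x, apply_mem_layer p K g.symm x.2⟩
  left_inv _ := Subtype.ext (g.symm_apply_apply _)
  right_inv _ := Subtype.ext (g.apply_symm_apply _)
  map_mul' _ _ := Subtype.ext (map_mul g _ _)
  map_add' _ _ := Subtype.ext (map_add g _ _)

variable [Fact p.Prime]

/-! ### The modules `A`, `B`, `B⁻` -/

/-- `A_n`, the `p`-part of the ideal class group of `K_n`. -/
abbrev An (n : ℕ) : Type _ := PPart p (ClassGroup (𝓞 (layer p K n)))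

/-- The norm map `N_{m,n} : A_m → A_n` for `n ≤ m`. -/
def normMap {n m : ℕ} (h : n ≤ m) : An p K m →ₗ[ℤ_[p]] An p K n :=
  letI : Algebra (layer p K n) (layer p K m) :=
    (IntermediateField.inclusion (layer_mono p K h)).toRingHom.toAlgebra
  PPart.map p (classNorm (layer p K n) (layer p K m))

/-- `A = lim A_n`, the norm coherent sequences. -/
def moduleA : Submodule ℤ_[p] (∀ n, An p K n) where
  carrier := {a | ∀ (n m : ℕ) (h : n ≤ m), normMap p K h (a m) = a n}
  add_mem' ha hb n m h := by simp [ha n m h, hb n m h]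
  zero_mem' n m h := by simp
  smul_mem' c a ha n m h := by simp [ha n m h]

/-- The class in `A_n` of a nonzero prime ideal of `K_n` (projected to the `p`-part). -/
def primeClass (n : ℕ) (v : HeightOneSpectrum (𝓞 (layer p K n))) : An p K n :=
  toPPart p (ClassGroup.mk0 ⟨v.asIdeal, mem_nonZeroDivisors_iff_ne_zero.2 v.ne_bot⟩)

/-- `B_n ⊂ A_n`, generated by the classes of the primes above `p`. -/
def Bn (n : ℕ) : Submodule ℤ_[p] (An p K n) :=
  Submodule.span ℤ_[p] {c | ∃ v : HeightOneSpectrum (𝓞 (layer p K n)),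
    (p : 𝓞 (layer p K n)) ∈ v.asIdeal ∧ c = primeClass p K n v}

/-- `B = lim B_n ⊂ A`. -/
def moduleB : Submodule ℤ_[p] (∀ n, An p K n) :=
  moduleA p K ⊓ Submodule.pi Set.univ (Bn p K)

variable [IsGalois ℚ K]

/-- The action of an automorphism on sequences of ideal classes, componentwise. -/
def galAct (g : Gal(AlgebraicClosure K/ℚ)) : (∀ n, An p K n) →ₗ[ℤ_[p]] (∀ n, An p K n) :=
  LinearMap.piMap fun n => PPart.map p
    (ClassGroup.mulEquiv (RingOfIntegers.mapRingEquiv (layerAut p K n g))).toMonoidHom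

/-- `B⁻ = (1 - j) B`, for a complex conjugation `j`. -/
def moduleBminus (j : Gal(AlgebraicClosure K/ℚ)) : Submodule ℤ_[p] (∀ n, An p K n) :=
  (moduleB p K).map (LinearMap.id - galAct p K j)

/-- The sequence `b = (b_n)`, where `b_n` is the class of `℘_n^{1 - j}`. -/
def seqB (j : Gal(AlgebraicClosure K/ℚ)) (P : ∀ n, HeightOneSpectrum (𝓞 (layer p K n))) :
    ∀ n, An p K n :=
  (fun n => primeClass p K n (P n)) - galAct p K j (fun n => primeClass p K n (P n))

end Tower

/-! ### Ramification and splitting hypotheses, decomposition groups -/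

section Primes

variable (p : ℕ) (K : Type*) [Field K] [NumberField K]

/-- Every prime `𝔭` of `K` above `p` is totally ramified in the cyclotomic `ℤ_p`-extension:
`𝔭 𝓞_{K_n} = 𝔓 ^ [K_n : K]` for every prime `𝔓` of `K_n` above `𝔭`. -/
def TotallyRamifiedAbove : Prop :=
  ∀ 𝔭 : Ideal (𝓞 K), 𝔭.IsPrime → (p : 𝓞 K) ∈ 𝔭 →
    ∀ n, ∀ 𝔓 ∈ 𝔭.primesOver (𝓞 (layer p K n)),
      𝔭.map (algebraMap (𝓞 K) (𝓞 (layer p K n))) = 𝔓 ^ Module.finrank K (layer p K n)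

/-- Every prime of `K⁺` above `p` splits in the quadratic extension `K/K⁺`. -/
def SplitAbove : Prop :=
  ∀ 𝔮 : Ideal (𝓞 (maximalRealSubfield K)), 𝔮.IsPrime → (p : 𝓞 (maximalRealSubfield K)) ∈ 𝔮 →
    (𝔮.primesOver (𝓞 K)).ncard = 2

/-- The decomposition group `D(℘⁺) ⊂ Δ⁺ = Gal(K⁺/ℚ)` of the prime `℘⁺ = ℘ ∩ K⁺`. -/
def decompPlus (P : Ideal (𝓞 K)) : Subgroup Gal(maximalRealSubfield K/ℚ) :=
  MulAction.stabilizer Gal(maximalRealSubfield K/ℚ) (P.under (𝓞 (maximalRealSubfield K)))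

/-- `r` is a system of representatives `C⁺ ⊂ Δ = Gal(K/ℚ)` for `Δ⁺/D(℘⁺)`: the restriction of
`r q` to `K⁺` lies in the coset `q`. -/
def IsRepresentatives (P : Ideal (𝓞 K))
    (r : Gal(maximalRealSubfield K/ℚ) ⧸ decompPlus K P → Gal(K/ℚ)) : Prop :=
  ∀ q, ∃ τ : Gal(maximalRealSubfield K/ℚ),
    (∀ x : maximalRealSubfield K, r q (x : K) = (τ x : K)) ∧ QuotientGroup.mk τ = q

/-- The set of pairs `{Q, Q̄}` of conjugate primes of `K` above `p`. -/
def conjPairs [IsCMField K] : Set (Set (Ideal (𝓞 K))) :=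
  {S | ∃ Q : Ideal (𝓞 K), Q.IsPrime ∧ (p : 𝓞 K) ∈ Q ∧
    S = {Q, Q.map (IsCMField.ringOfIntegersComplexConj K)}}

end Primes

end GrossKuzmin

end

noncomputable section

namespace GrossKuzmin

/-! ### `p`-parts -/

section PPart

variable (p : ℕ) [Fact p.Prime] {G H : Type*} [CommGroup G] [CommGroup H]

/-! Spanning. Total ramification puts exactly one prime `Q_n` of `K_n` above each prime `Q` of `K`
over `p`, and the norm of `Q_m` is `Q_n`; so the classes of the `Q_n` form an element `c_Q =
classSeq p Q` of `B`. At each level the `c_Q` generate `B_n`, and compactness of the space of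
coefficient vectors makes one vector work at all levels (`moduleB_eq_span`). An automorphism
restricting to `δ` on `K` sends `c_Q` to `c_{δQ}`, so the action on `B` factors through `Δ`. Hence
`B⁻` is spanned by the `c_Q - c_{jQ}`. Exchanging `Q` and `jQ` only changes the sign, so one prime
from each conjugate pair suffices; the pairs correspond to the primes of `K⁺` above `p`, that is, to
`Δ⁺/D(℘⁺)`.

Independence (`linearIndependent_classSeq_sub`). Given a relation with coefficients `c_i`,
approximate them at level `n` by natural numbers `a_i`. After raising to a power `t` prime to `p`,
the ideals `J = ∏ Q_{i,n}^{a_i t}` and `jJ` have the same class. This gives `α` such that `Y = α /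
jα` has divisor `2(jJ - J)`. For `g` trivial on `K` the divisor of `Y` is fixed by `g`, so `gY / Y`
is a unit; all its absolute values are `1`, so it is a root of unity. Choose `σ` trivial on `K` and
acting on these roots of unity by `w ↦ w^e`. Then `Y^e / σY` is fixed by every such `g` and lies in
`K`, so its valuation at `Q_{i,n}` is divisible by `[K_n : K]`. That valuation is `(e - 1) v(Y)`, as
`σ` fixes the divisor of `Y`. The power of `p` in `e - 1` is bounded independently of `n`, while
`[K_n : K]` is divisible by ever higher powers of `p`. So high powers of `p` divide `v(Y) = -2 a_i
t`, and letting `n` grow gives `c_i = 0`. The splitting hypothesis ensures that `jJ` contributes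
nothing at `Q_{i,n}`. -/

theorem toPPart_one : toPPart p (1 : G) = 0 := TensorProduct.tmul_zero _ _

theorem toPPart_mul (x y : G) : toPPart p (x * y) = toPPart p x + toPPart p y :=
  TensorProduct.tmul_add _ _ _

theorem toPPart_pow (x : G) (n : ℕ) : toPPart p (x ^ n) = n • toPPart p x := by
  induction n with
  | zero => simp [toPPart_one]
  | succ n ih => rw [pow_succ, toPPart_mul, ih, succ_nsmul]

theorem toPPart_prod {ι : Type*} (s : Finset ι) (x : ι → G) :
    toPPart p (∏ i ∈ s, x i) = ∑ i ∈ s, toPPart p (x i) := by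
  classical
  induction s using Finset.induction_on with
  | empty => simp [toPPart_one]
  | insert a s ha ih => rw [Finset.prod_insert ha, Finset.sum_insert ha, toPPart_mul, ih]

theorem PPart.map_toPPart (f : G →* H) (x : G) : PPart.map p f (toPPart p x) = toPPart p (f x) := by
  simp [PPart.map, toPPart]

/-- The group order kills everything, and its prime-to-`p` part is a unit of `ℤ_p`. -/
theorem PPart.exists_pow_smul_eq_zero [Finite G] :
    ∃ M : ℕ, ∀ a : PPart p G, (p : ℤ_[p]) ^ M • a = 0 := by
  have hpp : p.Prime := Fact.out
  obtain ⟨k, m, hm, hN⟩ := Nat.exists_eq_pow_mul_and_not_dvd (n := Nat.card G)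
    Nat.card_pos.ne' p hpp.ne_one
  refine ⟨k, fun a => ?_⟩
  have hu : IsUnit (m : ℤ_[p]) := by
    rw [PadicInt.isUnit_iff, PadicInt.norm_natCast_eq_one_iff]
    exact hpp.coprime_iff_not_dvd.2 hm
  refine (hu.smul_eq_zero).1 ?_
  rw [smul_smul]
  have : (m : ℤ_[p]) * (p : ℤ_[p]) ^ k = (Nat.card G : ℕ) := by rw [hN]; push_cast; ring
  rw [this, Nat.cast_smul_eq_nsmul]
  induction a using TensorProduct.induction_on with
  | zero => simp
  | add a b ha hb => rw [smul_add, ha, hb, add_zero]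
  | tmul z g =>
    have : (Nat.card G) • g = 0 := by
      have : (Additive.toMul g) ^ Nat.card G = 1 := pow_card_eq_one'
      exact congrArg Additive.ofMul this
    rw [← TensorProduct.tmul_smul, this, TensorProduct.tmul_zero]

/-- With `t` the prime-to-`p` part of the group order, `x ^ t` lies in the `p`-primary component,
where `toPPart` is injective. This turns relations in `A_n` back into relations between actual ideal
classes. -/
theorem exists_pow_eq_one_of_toPPart_eq_zero [Finite G] {x : G} (hx : toPPart p x = 0) :
    ∃ t : ℕ, ¬ p ∣ t ∧ x ^ t = 1 := by
  have hpp : p.Prime := Fact.out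
  obtain ⟨k, m, hm, hN⟩ := Nat.exists_eq_pow_mul_and_not_dvd (n := Nat.card G)
    Nat.card_pos.ne' p hpp.ne_one
  refine ⟨m, hm, ?_⟩
  have hmem : x ^ m ∈ CommGroup.primaryComponent G p := by
    refine ⟨k, ?_⟩
    rw [← pow_mul, mul_comm, ← hN]
    exact pow_card_eq_one'
  have h := (pPart_bijective p G).1 (a₁ := ⟨x ^ m, hmem⟩) (a₂ := 1)
    (by simp [toPPart_pow, hx, toPPart_one])
  exact congrArg Subtype.val h

end PPart

/-! ### Isomorphisms and ideal classes -/

theorem mulEquiv_mk0 {R S : Type*} [CommRing R] [IsDedekindDomain R] [CommRing S]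
    [IsDedekindDomain S] (e : R ≃+* S) (I : (Ideal R)⁰) (J : (Ideal S)⁰)
    (h : (I : Ideal R).map e = J) :
    ClassGroup.mulEquiv e (ClassGroup.mk0 I) = ClassGroup.mk0 J := by
  -- `ClassGroup.mulEquiv` is built from fractional ideals, so the comparison is made in the
  -- fraction fields.
  rw [← (ClassGroup.equiv (FractionRing S)).injective.eq_iff, ClassGroup.equiv_mk0]
  simp only [ClassGroup.mulEquiv, MulEquiv.trans_apply, MulEquiv.apply_symm_apply]
  rw [ClassGroup.equiv_mk0]
  refine congrArg (QuotientGroup.mk' (toPrincipalIdeal S (FractionRing S)).range) ?_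
  ext1
  change FractionalIdeal.ringEquivOfRingEquiv (FractionRing R) (FractionRing S) e
    ((I : Ideal R) : FractionalIdeal R⁰ (FractionRing R)) =
    ((J : Ideal S) : FractionalIdeal S⁰ (FractionRing S))
  rw [← h]
  ext x
  rw [FractionalIdeal.mem_coeIdeal, ← FractionalIdeal.mem_coe, ← FractionalIdeal.val_eq_coe,
    FractionalIdeal.ringEquivOfRingEquiv_apply_val, Submodule.mem_map]
  constructor
  · rintro ⟨y, hy, rfl⟩
    obtain ⟨z, hz, rfl⟩ := (FractionalIdeal.mem_coeIdeal _).1 hy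
    exact ⟨e z, Ideal.mem_map_of_mem e hz,
      (IsFractionRing.semilinearEquivOfRingEquiv_algebraMap _ _ e z).symm⟩
  · rintro ⟨y, hy, rfl⟩
    obtain ⟨z, hz, rfl⟩ := (Ideal.mem_map_iff_of_surjective e e.surjective).1 hy
    exact ⟨algebraMap _ _ z, FractionalIdeal.mem_coeIdeal_of_mem _ hz,
      IsFractionRing.semilinearEquivOfRingEquiv_algebraMap _ _ e z⟩

/-! ### Compactness -/

/-- The solution sets at the various levels are nonempty, nested by `hf`, and closed in the compact
space `ι → ℤ_p`; hence they have a common point. They are closed because each is a coset of an open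
subgroup: the kernel contains `p ^ M` times everything. -/
theorem exists_forall_apply_eq {p : ℕ} [Fact p.Prime] {ι : Type*} [Finite ι] {N : ℕ → Type*}
    [∀ n, AddCommGroup (N n)] [∀ n, Module ℤ_[p] (N n)]
    (hN : ∀ n, ∃ M : ℕ, ∀ a : N n, (p : ℤ_[p]) ^ M • a = 0)
    (f : ∀ n, (ι → ℤ_[p]) →ₗ[ℤ_[p]] N n) (x : ∀ n, N n) (hx : ∀ n, ∃ c, f n c = x n)
    (hf : ∀ n m, n ≤ m → ∀ c, f m c = x m → f n c = x n) :
    ∃ c, ∀ n, f n c = x n := by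
  have hopen : ∀ n, IsOpen ((LinearMap.ker (f n)).toAddSubgroup : Set (ι → ℤ_[p])) := by
    intro n
    obtain ⟨M, hM⟩ := hN n
    apply AddSubgroup.isOpen_of_mem_nhds _ (g := 0)
    have : Set.pi Set.univ (fun _ : ι => {z : ℤ_[p] | (p : ℤ_[p]) ^ M ∣ z}) ∈ nhds (0 : ι → ℤ_[p]) := by
      refine set_pi_mem_nhds Set.finite_univ fun i _ => ?_
      refine Metric.mem_nhds_iff.2 ⟨(p : ℝ) ^ (-(M : ℤ)), ?_, fun z hz => ?_⟩
      · have := (Fact.out : p.Prime).pos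
        positivity
      · rw [Set.mem_ofPred_eq, ← Ideal.mem_span_singleton, ← PadicInt.norm_le_pow_iff_mem_span_pow]
        simpa using (Metric.mem_ball.1 hz).le
    refine Filter.mem_of_superset this fun z hz => ?_
    choose w hw using fun i => hz i (Set.mem_univ i)
    have : z = (p : ℤ_[p]) ^ M • w := funext hw
    change f n z = 0
    rw [this, map_smul, hM]
  have hclosed : ∀ n, IsClosed {c | f n c = x n} := by
    intro n
    obtain ⟨c₀, hc₀⟩ := hx n
    have h1 := AddSubgroup.isClosed_of_isOpen _ (hopen n)
    have : {c | f n c = x n} = (fun c => c - c₀) ⁻¹'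
        ((LinearMap.ker (f n)).toAddSubgroup : Set (ι → ℤ_[p])) := by
      ext c
      simp [hc₀, sub_eq_zero]
    rw [this]
    exact h1.preimage (by fun_prop)
  obtain ⟨c, hc⟩ := IsCompact.nonempty_iInter_of_sequence_nonempty_isCompact_isClosed
    (fun n => {c | f n c = x n}) (fun n c hc => hf n (n + 1) n.le_succ c hc) hx
    (hclosed 0).isCompact hclosed
  exact ⟨c, fun n => Set.mem_iInter.1 hc n⟩

/-! ### Multiplicities of primes -/

section Val

variable {R : Type*} [CommRing R] [IsDedekindDomain R]

open Classical UniqueFactorizationMonoid in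
/-- The multiplicity of a prime in an ideal (`0` for the zero ideal). -/
def idealVal (v : HeightOneSpectrum R) (I : Ideal R) : ℕ :=
  (normalizedFactors I).count v.asIdeal

open UniqueFactorizationMonoid

theorem idealVal_mul (v : HeightOneSpectrum R) {I J : Ideal R} (hI : I ≠ ⊥) (hJ : J ≠ ⊥) :
    idealVal v (I * J) = idealVal v I + idealVal v J := by
  rw [idealVal, normalizedFactors_mul hI hJ, Multiset.count_add, idealVal, idealVal]

theorem idealVal_pow (v : HeightOneSpectrum R) (I : Ideal R) (n : ℕ) :
    idealVal v (I ^ n) = n * idealVal v I := by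
  rw [idealVal, normalizedFactors_pow, Multiset.count_nsmul, idealVal]

theorem idealVal_self (v : HeightOneSpectrum R) : idealVal v v.asIdeal = 1 := by
  rw [idealVal, normalizedFactors_irreducible v.irreducible, normalize_eq,
    Multiset.count_singleton_self]

theorem idealVal_eq_zero_of_not_le (v : HeightOneSpectrum R) {I : Ideal R} (h : ¬ I ≤ v.asIdeal) :
    idealVal v I = 0 := by
  classical
  rw [idealVal, Multiset.count_eq_zero]
  intro hm
  exact h (Ideal.dvd_iff_le.1 (dvd_of_mem_normalizedFactors hm))

theorem idealVal_of_ne {v w : HeightOneSpectrum R} (h : v ≠ w) : idealVal v w.asIdeal = 0 := by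
  refine idealVal_eq_zero_of_not_le v fun hle => h ?_
  ext1
  exact (w.isMaximal.eq_of_le v.isPrime.ne_top hle).symm

theorem idealVal_prod (v : HeightOneSpectrum R) {ι : Type*} (s : Finset ι) (I : ι → Ideal R)
    (hI : ∀ i ∈ s, I i ≠ ⊥) : idealVal v (∏ i ∈ s, I i) = ∑ i ∈ s, idealVal v (I i) := by
  classical
  induction s using Finset.induction_on with
  | empty =>
    rw [Finset.prod_empty, Finset.sum_empty]
    refine idealVal_eq_zero_of_not_le v fun h => v.isPrime.ne_top (top_le_iff.1 ?_)
    rwa [← Ideal.one_eq_top]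
  | insert a s ha ih =>
    rw [Finset.prod_insert ha, Finset.sum_insert ha, idealVal_mul,
      ih fun i hi => hI i (Finset.mem_insert_of_mem hi)]
    · exact hI a (Finset.mem_insert_self _ _)
    · exact Finset.prod_ne_zero_iff.2 fun i hi => hI i (Finset.mem_insert_of_mem hi)

end Val

/-! ### Norms of totally ramified primes -/

/-- The norm of `w` is some power `v ^ s`. The norm from `E` to `F` of the extension of `Q` to `E`
is then `v ^ (s [E:K])`; it is also the `[E:F]`-th power of the extension of `Q` to `F`, which is `v
^ ([F:K][E:F])`. Comparing exponents forces `s = 1`. -/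
theorem relNorm_eq_of_map_eq_pow {K F E : Type*} [Field K] [NumberField K] [Field F]
    [NumberField F] [Field E] [NumberField E] [Algebra K F] [Algebra F E] [Algebra K E]
    [IsScalarTower K F E] (Q : Ideal (𝓞 K)) (v : Ideal (𝓞 F)) (w : Ideal (𝓞 E))
    [hv : v.IsPrime] (hv0 : v ≠ ⊥) (hw : w.under (𝓞 F) = v)
    (h1 : Q.map (algebraMap (𝓞 K) (𝓞 F)) = v ^ Module.finrank K F)
    (h2 : Q.map (algebraMap (𝓞 K) (𝓞 E)) = w ^ Module.finrank K E) :
    Ideal.relNorm (𝓞 F) w = v := by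
  have : w.LiesOver v := ⟨hw.symm⟩
  obtain ⟨s, hs⟩ := Ideal.exists_relNorm_eq_pow_of_isPrime w v
  have h := Ideal.relNorm_algebraMap' (𝓞 F) (S := 𝓞 E) Q
  have hf : Module.finrank (𝓞 F) (𝓞 E) = Module.finrank F E :=
    (IsFractionRing.finrank_eq (𝓞 F) F (𝓞 E) E).symm
  have : Module.Finite K F := Module.Finite.of_restrictScalars_finite ℚ K F
  have : Module.Finite F E := Module.Finite.of_restrictScalars_finite ℚ F E
  rw [h1, h2, map_pow, hs, ← pow_mul, ← pow_mul, hf, Module.finrank_mul_finrank] at h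
  have hinj := IsLeftCancelMulZero.mul_left_cancel_of_ne_zero hv0
  have hvt : v ≠ 1 := by rw [Ideal.one_eq_top]; exact hv.ne_top
  have h3 := (hinj.pow_injective hvt) h
  have hpos : 0 < Module.finrank K E := by
    rw [← Module.finrank_mul_finrank K F E]
    exact Nat.mul_pos Module.finrank_pos Module.finrank_pos
  have : s = 1 := by
    apply Nat.eq_of_mul_eq_mul_right hpos
    rw [h3, one_mul]
  rw [hs, this, pow_one]

/-! ### Primes of the layers -/

set_option linter.unusedSectionVars false

section Layers

variable (p : ℕ) (K : Type*) [Field K] [NumberField K]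

variable {K} in
/-- The prime `δ Q`. -/
def galPrime (δ : Gal(K/ℚ)) (Q : HeightOneSpectrum (𝓞 K)) : HeightOneSpectrum (𝓞 K) :=
  HeightOneSpectrum.equivOfRingEquiv (RingOfIntegers.mapRingEquiv δ.toRingEquiv) Q

variable {K} in
theorem mem_galPrime {δ : Gal(K/ℚ)} {Q : HeightOneSpectrum (𝓞 K)} {x : 𝓞 K} :
    x ∈ (galPrime δ Q).asIdeal ↔
      (RingOfIntegers.mapRingEquiv δ.toRingEquiv).symm x ∈ Q.asIdeal := Iff.rfl

variable {K} in
theorem galPrime_one (Q : HeightOneSpectrum (𝓞 K)) : galPrime 1 Q = Q := by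
  ext x
  rw [mem_galPrime]
  rfl

variable {K} in
theorem galPrime_mul (δ ε : Gal(K/ℚ)) (Q : HeightOneSpectrum (𝓞 K)) :
    galPrime (δ * ε) Q = galPrime δ (galPrime ε Q) := by
  ext x
  simp only [mem_galPrime]
  rfl

variable {K p} in
theorem natCast_mem_galPrime {δ : Gal(K/ℚ)} {Q : HeightOneSpectrum (𝓞 K)}
    (h : (p : 𝓞 K) ∈ Q.asIdeal) : (p : 𝓞 K) ∈ (galPrime δ Q).asIdeal := by
  rw [mem_galPrime, map_natCast]
  exact h

variable {K} in
theorem galPrime_asIdeal (δ : Gal(K/ℚ)) (Q : HeightOneSpectrum (𝓞 K)) :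
    (galPrime δ Q).asIdeal = δ • Q.asIdeal := by
  ext x
  rw [mem_galPrime, Ideal.mem_pointwise_smul_iff_inv_smul_mem]
  rfl

variable {p K} in
theorem exists_galPrime_eq [hp : Fact p.Prime] [IsGalois ℚ K] {Q Q' : HeightOneSpectrum (𝓞 K)}
    (hQ : (p : 𝓞 K) ∈ Q.asIdeal) (hQ' : (p : 𝓞 K) ∈ Q'.asIdeal) :
    ∃ δ : Gal(K/ℚ), galPrime δ Q = Q' := by
  have key : ∀ R : HeightOneSpectrum (𝓞 K), (p : 𝓞 K) ∈ R.asIdeal →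
      R.asIdeal.LiesOver (Ideal.span {(p : ℤ)}) := by
    intro R hR
    constructor
    have hmax : (Ideal.span {(p : ℤ)}).IsMaximal :=
      PrincipalIdealRing.isMaximal_of_irreducible
        (Nat.prime_iff_prime_int.1 hp.out).irreducible
    refine hmax.eq_of_le (Ideal.IsPrime.under ℤ R.asIdeal).ne_top ?_
    rw [Ideal.span_singleton_le_iff_mem, Ideal.mem_comap]
    simpa using hR
  have := key Q hQ
  have := key Q' hQ'
  obtain ⟨σ, hσ⟩ := Ideal.exists_smul_eq_of_isGaloisGroup (Ideal.span {(p : ℤ)}) Q.asIdeal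
    Q'.asIdeal Gal(K/ℚ)
  exact ⟨σ, HeightOneSpectrum.ext ((galPrime_asIdeal σ Q).trans hσ)⟩

variable [Fact p.Prime]

theorem exists_prime_above (n : ℕ) (Q : HeightOneSpectrum (𝓞 K)) :
    ∃ v : HeightOneSpectrum (𝓞 (layer p K n)), v.asIdeal.under (𝓞 K) = Q.asIdeal := by
  have := Q.isMaximal
  obtain ⟨⟨v, hv, hv'⟩⟩ := (inferInstance :
    Nonempty (Q.asIdeal.primesOver (𝓞 (layer p K n))))
  refine ⟨⟨v, hv, ?_⟩, hv'.over.symm⟩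
  rintro rfl
  apply Q.ne_bot
  rw [hv'.over, Ideal.under_bot]

/-- A prime of `K_n` above `Q`. -/
def primeAbove (n : ℕ) (Q : HeightOneSpectrum (𝓞 K)) : HeightOneSpectrum (𝓞 (layer p K n)) :=
  (exists_prime_above p K n Q).choose

theorem primeAbove_under (n : ℕ) (Q : HeightOneSpectrum (𝓞 K)) :
    (primeAbove p K n Q).asIdeal.under (𝓞 K) = Q.asIdeal :=
  (exists_prime_above p K n Q).choose_spec

variable {p K}

theorem TotallyRamifiedAbove.map_eq (hram : TotallyRamifiedAbove p K) {n : ℕ}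
    {v : HeightOneSpectrum (𝓞 (layer p K n))} {Q : HeightOneSpectrum (𝓞 K)}
    (hQ : (p : 𝓞 K) ∈ Q.asIdeal) (hv : v.asIdeal.under (𝓞 K) = Q.asIdeal) :
    Q.asIdeal.map (algebraMap (𝓞 K) (𝓞 (layer p K n))) =
      v.asIdeal ^ Module.finrank K (layer p K n) :=
  hram Q.asIdeal Q.isPrime hQ n v.asIdeal ⟨v.isPrime, ⟨hv.symm⟩⟩

theorem finrank_layer_pos (n : ℕ) : 0 < Module.finrank K (layer p K n) := by
  have : Module.Finite K (layer p K n) := Module.Finite.of_restrictScalars_finite ℚ K _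
  exact Module.finrank_pos

/-- Two primes over `Q` have equal `[K_n : K]`-th powers, so one contains the other. This makes the
choice in `primeAbove` canonical, hence compatible with norms and with Galois. -/
theorem TotallyRamifiedAbove.eq_primeAbove (hram : TotallyRamifiedAbove p K) {n : ℕ}
    {v : HeightOneSpectrum (𝓞 (layer p K n))} {Q : HeightOneSpectrum (𝓞 K)}
    (hQ : (p : 𝓞 K) ∈ Q.asIdeal) (hv : v.asIdeal.under (𝓞 K) = Q.asIdeal) :
    v = primeAbove p K n Q := by
  have h1 := hram.map_eq hQ hv
  rw [hram.map_eq hQ (primeAbove_under p K n Q)] at h1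
  have h2 : v.asIdeal ^ Module.finrank K (layer p K n) ≤ (primeAbove p K n Q).asIdeal :=
    h1 ▸ Ideal.pow_le_self (finrank_layer_pos n).ne'
  have h3 := (primeAbove p K n Q).isPrime.le_of_pow_le h2
  ext1
  exact v.isMaximal.eq_of_le (primeAbove p K n Q).isPrime.ne_top h3

/-- The prime of `K` below a prime of `K_n`. -/
def primeBelow {n : ℕ} (v : HeightOneSpectrum (𝓞 (layer p K n))) : HeightOneSpectrum (𝓞 K) where
  asIdeal := v.asIdeal.under (𝓞 K)
  isPrime := v.isPrime.under _
  ne_bot h := v.ne_bot (Ideal.eq_bot_of_comap_eq_bot h)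

theorem natCast_mem_primeBelow {n : ℕ} {v : HeightOneSpectrum (𝓞 (layer p K n))}
    (h : (p : 𝓞 (layer p K n)) ∈ v.asIdeal) : (p : 𝓞 K) ∈ (primeBelow v).asIdeal := by
  change algebraMap (𝓞 K) (𝓞 (layer p K n)) p ∈ v.asIdeal
  rwa [map_natCast]

theorem natCast_mem_primeAbove {n : ℕ} {Q : HeightOneSpectrum (𝓞 K)}
    (h : (p : 𝓞 K) ∈ Q.asIdeal) : (p : 𝓞 (layer p K n)) ∈ (primeAbove p K n Q).asIdeal := by
  rw [← primeAbove_under p K n Q, Ideal.mem_comap, map_natCast] at h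
  exact h

theorem primeAbove_injective (n : ℕ) : Function.Injective (primeAbove p K n) := by
  intro Q Q' h
  ext1
  rw [← primeAbove_under p K n Q, h, primeAbove_under]

variable (p) in
/-- The sequence of the classes of the primes above `Q`. -/
def classSeq (Q : HeightOneSpectrum (𝓞 K)) : ∀ n, An p K n :=
  fun n => primeClass p K n (primeAbove p K n Q)

theorem normMap_classSeq (hram : TotallyRamifiedAbove p K) {Q : HeightOneSpectrum (𝓞 K)}
    (hQ : (p : 𝓞 K) ∈ Q.asIdeal) {n m : ℕ} (h : n ≤ m) :
    normMap p K h (classSeq p Q m) = classSeq p Q n := by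
  let _ : Algebra (layer p K n) (layer p K m) :=
    (IntermediateField.inclusion (layer_mono p K h)).toRingHom.toAlgebra
  have : IsScalarTower K (layer p K n) (layer p K m) := IsScalarTower.of_algebraMap_eq' rfl
  change PPart.map p (classNorm (layer p K n) (layer p K m)) _ = _
  rw [classSeq, primeClass, PPart.map_toPPart, classNorm_mk0, classSeq, primeClass]
  congr 2
  ext1
  let w : HeightOneSpectrum (𝓞 (layer p K n)) :=
    { asIdeal := (primeAbove p K m Q).asIdeal.under (𝓞 (layer p K n))
      isPrime := (primeAbove p K m Q).isPrime.under _
      ne_bot := fun h => (primeAbove p K m Q).ne_bot (Ideal.eq_bot_of_comap_eq_bot h) }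
  have hw : w.asIdeal.under (𝓞 K) = Q.asIdeal := by
    rw [← primeAbove_under p K m Q]
    exact Ideal.under_under _
  have hwe := hram.eq_primeAbove hQ hw
  exact relNorm_eq_of_map_eq_pow Q.asIdeal (primeAbove p K n Q).asIdeal
    (primeAbove p K m Q).asIdeal (hv := (primeAbove p K n Q).isPrime) (primeAbove p K n Q).ne_bot
    (congrArg HeightOneSpectrum.asIdeal hwe) (hram.map_eq hQ (primeAbove_under p K n Q))
    (hram.map_eq hQ (primeAbove_under p K m Q))

variable [IsGalois ℚ K]

/-- The restriction to `K` of an automorphism of the algebraic closure. -/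
abbrev resK : Gal(AlgebraicClosure K/ℚ) →* Gal(K/ℚ) := AlgEquiv.restrictNormalHom K

theorem algebraMap_resK (g : Gal(AlgebraicClosure K/ℚ)) (x : K) :
    algebraMap K (AlgebraicClosure K) (resK g x) = g (algebraMap K (AlgebraicClosure K) x) :=
  AlgEquiv.restrictNormal_commutes g K x

theorem resK_surjective : Function.Surjective (resK (K := K)) :=
  have : IsAlgClosure ℚ (AlgebraicClosure K) := ⟨inferInstance, Algebra.IsAlgebraic.trans ℚ K _⟩
  have := IsAlgClosure.normal ℚ (AlgebraicClosure K)
  AlgEquiv.restrictNormalHom_surjective (AlgebraicClosure K)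

theorem resK_eq_iff {g : Gal(AlgebraicClosure K/ℚ)} {δ : Gal(K/ℚ)} :
    resK g = δ ↔ ∀ x : K, g (algebraMap K (AlgebraicClosure K) x) =
      algebraMap K (AlgebraicClosure K) (δ x) := by
  constructor
  · rintro rfl x
    exact (algebraMap_resK g x).symm
  · intro h
    ext x
    apply (algebraMap K (AlgebraicClosure K)).injective
    rw [algebraMap_resK, h]

variable (p) in
/-- The automorphism of the ring of integers of `K_n` induced by an automorphism of the algebraic
closure. -/
abbrev layerIntAut (n : ℕ) (g : Gal(AlgebraicClosure K/ℚ)) :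
    𝓞 (layer p K n) ≃+* 𝓞 (layer p K n) :=
  RingOfIntegers.mapRingEquiv (layerAut p K n g)

theorem layerIntAut_algebraMap (n : ℕ) (g : Gal(AlgebraicClosure K/ℚ)) (x : 𝓞 K) :
    layerIntAut p n g (algebraMap _ _ x) =
      algebraMap _ _ (RingOfIntegers.mapRingEquiv (resK g).toRingEquiv x) := by
  ext
  exact (algebraMap_resK g x).symm

theorem equiv_primeAbove (hram : TotallyRamifiedAbove p K) {Q : HeightOneSpectrum (𝓞 K)}
    (hQ : (p : 𝓞 K) ∈ Q.asIdeal) (n : ℕ) (g : Gal(AlgebraicClosure K/ℚ)) :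
    HeightOneSpectrum.equivOfRingEquiv (layerIntAut p n g) (primeAbove p K n Q) =
      primeAbove p K n (galPrime (resK g) Q) := by
  apply hram.eq_primeAbove (natCast_mem_galPrime hQ)
  ext x
  rw [mem_galPrime, ← primeAbove_under p K n Q, Ideal.mem_comap, Ideal.mem_comap]
  have : algebraMap (𝓞 K) (𝓞 (layer p K n))
      ((RingOfIntegers.mapRingEquiv (resK g).toRingEquiv).symm x) =
      (layerIntAut p n g).symm (algebraMap _ _ x) := by
    rw [RingEquiv.eq_symm_apply, layerIntAut_algebraMap, RingEquiv.apply_symm_apply]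
  rw [this]
  rfl

theorem map_primeAbove (hram : TotallyRamifiedAbove p K) {Q : HeightOneSpectrum (𝓞 K)}
    (hQ : (p : 𝓞 K) ∈ Q.asIdeal) (n : ℕ) (g : Gal(AlgebraicClosure K/ℚ)) :
    (primeAbove p K n Q).asIdeal.map (layerIntAut p n g) =
      (primeAbove p K n (galPrime (resK g) Q)).asIdeal := by
  rw [← equiv_primeAbove hram hQ]
  exact (Ideal.comap_symm _).symm

/-- Only the restriction of `g` to `K` enters on the right; this is why `Δ` itself acts on `B`. -/
theorem galAct_classSeq (hram : TotallyRamifiedAbove p K) {Q : HeightOneSpectrum (𝓞 K)}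
    (hQ : (p : 𝓞 K) ∈ Q.asIdeal) (g : Gal(AlgebraicClosure K/ℚ)) :
    galAct p K g (classSeq p Q) = classSeq p (galPrime (resK g) Q) := by
  funext n
  refine (PPart.map_toPPart p _ _).trans (congrArg (toPPart p) ?_)
  exact mulEquiv_mk0 _ _ _ (map_primeAbove hram hQ n g)

end Layers

/-! ### The module `B` -/

section ModuleB

set_option linter.unusedSectionVars false

variable {p : ℕ} {K : Type*} [Field K] [NumberField K] [Fact p.Prime]

theorem exists_pow_smul_An_eq_zero (n : ℕ) : ∃ M : ℕ, ∀ a : An p K n, (p : ℤ_[p]) ^ M • a = 0 :=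
  PPart.exists_pow_smul_eq_zero p

theorem classSeq_mem_moduleB (hram : TotallyRamifiedAbove p K) {Q : HeightOneSpectrum (𝓞 K)}
    (hQ : (p : 𝓞 K) ∈ Q.asIdeal) : classSeq p Q ∈ moduleB p K := by
  refine ⟨fun n m h => normMap_classSeq hram hQ h, fun n _ => ?_⟩
  exact Submodule.subset_span ⟨_, natCast_mem_primeAbove hQ, rfl⟩

variable [IsGalois ℚ K]

theorem Bn_eq_span (hram : TotallyRamifiedAbove p K) {P : HeightOneSpectrum (𝓞 K)}
    (hP : (p : 𝓞 K) ∈ P.asIdeal) (n : ℕ) :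
    Bn p K n = Submodule.span ℤ_[p]
      (Set.range fun δ : Gal(K/ℚ) => classSeq p (galPrime δ P) n) := by
  apply le_antisymm
  · refine Submodule.span_le.2 ?_
    rintro _ ⟨v, hv, rfl⟩
    have hv' := natCast_mem_primeBelow hv
    obtain ⟨δ, hδ⟩ := exists_galPrime_eq hP hv'
    apply Submodule.subset_span
    refine ⟨δ, ?_⟩
    simp only [hδ]
    exact congrArg (primeClass p K n) (hram.eq_primeAbove hv' rfl).symm
  · refine Submodule.span_le.2 ?_
    rintro _ ⟨δ, rfl⟩
    exact Submodule.subset_span ⟨_, natCast_mem_primeAbove (natCast_mem_galPrime hP), rfl⟩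

theorem moduleB_eq_span (hram : TotallyRamifiedAbove p K) {P : HeightOneSpectrum (𝓞 K)}
    (hP : (p : 𝓞 K) ∈ P.asIdeal) :
    moduleB p K = Submodule.span ℤ_[p]
      (Set.range fun δ : Gal(K/ℚ) => classSeq p (galPrime δ P)) := by
  apply le_antisymm
  · rintro x ⟨hxA, hxB⟩
    have hxB' : ∀ n, x n ∈ Bn p K n := fun n => hxB n (Set.mem_univ n)
    obtain ⟨c, hc⟩ := exists_forall_apply_eq (exists_pow_smul_An_eq_zero (K := K))
      (fun n => Fintype.linearCombination ℤ_[p]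
        (fun δ : Gal(K/ℚ) => classSeq p (galPrime δ P) n)) x
      (fun n => by
        have := hxB' n
        rw [Bn_eq_span hram hP, ← Fintype.range_linearCombination ℤ_[p]] at this
        exact this)
      -- A coefficient vector valid at level `m` is valid at level `n`: apply the norm, which is
      -- compatible with both sides.
      (fun n m h c hc => by
        have := congrArg (normMap p K h) hc
        rw [hxA n m h] at this
        rw [← this]
        simp only [Fintype.linearCombination_apply, map_sum, map_smul]
        refine Finset.sum_congr rfl fun δ _ => ?_
        rw [normMap_classSeq hram (natCast_mem_galPrime hP) h])
    have : x = ∑ δ : Gal(K/ℚ), c δ • classSeq p (galPrime δ P) := by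
      funext n
      rw [← hc n, Fintype.linearCombination_apply, Finset.sum_apply]
      rfl
    rw [this]
    exact Submodule.sum_mem _ fun δ _ =>
      Submodule.smul_mem _ _ (Submodule.subset_span (Set.mem_range_self δ))
  · refine Submodule.span_le.2 ?_
    rintro _ ⟨δ, rfl⟩
    exact classSeq_mem_moduleB hram (natCast_mem_galPrime hP)

theorem moduleB_induction (hram : TotallyRamifiedAbove p K) {P : HeightOneSpectrum (𝓞 K)}
    (hP : (p : 𝓞 K) ∈ P.asIdeal) {f g : (∀ n, An p K n) →ₗ[ℤ_[p]] (∀ n, An p K n)}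
    (h : ∀ Q : HeightOneSpectrum (𝓞 K), (p : 𝓞 K) ∈ Q.asIdeal →
      f (classSeq p Q) = g (classSeq p Q)) {y : ∀ n, An p K n} (hy : y ∈ moduleB p K) :
    f y = g y := by
  rw [moduleB_eq_span hram hP] at hy
  refine LinearMap.eqOn_span (f := f) (g := g) ?_ hy
  rintro _ ⟨δ, rfl⟩
  exact h _ (natCast_mem_galPrime hP)

theorem galAct_congr (hram : TotallyRamifiedAbove p K) {P : HeightOneSpectrum (𝓞 K)}
    (hP : (p : 𝓞 K) ∈ P.asIdeal) {g h : Gal(AlgebraicClosure K/ℚ)} (hgh : resK g = resK h)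
    {y : ∀ n, An p K n} (hy : y ∈ moduleB p K) : galAct p K g y = galAct p K h y :=
  moduleB_induction hram hP (fun Q hQ => by
    rw [galAct_classSeq hram hQ, galAct_classSeq hram hQ, hgh]) hy

theorem galAct_mul (hram : TotallyRamifiedAbove p K) {P : HeightOneSpectrum (𝓞 K)}
    (hP : (p : 𝓞 K) ∈ P.asIdeal) (g h : Gal(AlgebraicClosure K/ℚ))
    {y : ∀ n, An p K n} (hy : y ∈ moduleB p K) :
    galAct p K (g * h) y = galAct p K g (galAct p K h y) :=
  moduleB_induction hram hP (g := (galAct p K g).comp (galAct p K h)) (fun Q hQ => by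
    rw [LinearMap.comp_apply, galAct_classSeq hram hQ, galAct_classSeq hram hQ,
      galAct_classSeq hram (natCast_mem_galPrime hQ), map_mul, galPrime_mul]) hy

theorem galAct_one (hram : TotallyRamifiedAbove p K) {P : HeightOneSpectrum (𝓞 K)}
    (hP : (p : 𝓞 K) ∈ P.asIdeal) {y : ∀ n, An p K n} (hy : y ∈ moduleB p K) :
    galAct p K 1 y = y :=
  moduleB_induction hram hP (g := LinearMap.id) (fun Q hQ => by
    rw [LinearMap.id_apply, galAct_classSeq hram hQ, map_one, galPrime_one]) hy

theorem galAct_mem_moduleB (hram : TotallyRamifiedAbove p K) {P : HeightOneSpectrum (𝓞 K)}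
    (hP : (p : 𝓞 K) ∈ P.asIdeal) (g : Gal(AlgebraicClosure K/ℚ))
    {y : ∀ n, An p K n} (hy : y ∈ moduleB p K) : galAct p K g y ∈ moduleB p K := by
  rw [moduleB_eq_span hram hP] at hy
  have : Submodule.span ℤ_[p] (Set.range fun δ : Gal(K/ℚ) => classSeq p (galPrime δ P)) ≤
      (moduleB p K).comap (galAct p K g) := by
    refine Submodule.span_le.2 ?_
    rintro _ ⟨δ, rfl⟩
    change galAct p K g (classSeq p (galPrime δ P)) ∈ moduleB p K
    rw [galAct_classSeq hram (natCast_mem_galPrime hP)]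
    exact classSeq_mem_moduleB hram (natCast_mem_galPrime (natCast_mem_galPrime hP))
  exact this hy

end ModuleB

/-! ### Complex conjugation -/

section Conj

set_option linter.unusedSectionVars false

variable {K : Type*} [Field K] [NumberField K] [IsCMField K]

theorem resK_eq_complexConj [IsGalois ℚ K] {j : Gal(AlgebraicClosure K/ℚ)}
    {φ : AlgebraicClosure K →+* ℂ} (hj : ComplexEmbedding.IsConj φ j) (x : K) :
    resK j x = IsCMField.complexConj K x := by
  apply (φ.comp (algebraMap K (AlgebraicClosure K))).injective
  rw [IsCMField.complexEmbedding_complexConj, RingHom.comp_apply, algebraMap_resK, hj.eq]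
  rfl

/-- For any embedding `ψ`, both `ψ` and `ψ ∘ δ` intertwine `complexConj` with conjugation on `ℂ`. -/
theorem complexConj_comm (δ : Gal(K/ℚ)) (x : K) :
    δ (IsCMField.complexConj K x) = IsCMField.complexConj K (δ x) := by
  obtain ⟨ψ⟩ : Nonempty (K →+* ℂ) := inferInstance
  apply ψ.injective
  rw [IsCMField.complexEmbedding_complexConj]
  exact IsCMField.complexEmbedding_complexConj K (ψ.comp δ.toRingEquiv.toRingHom) x

variable (K) in
/-- Complex conjugation as an element of `Gal(K/ℚ)`. -/
def conjQ : Gal(K/ℚ) := (IsCMField.complexConj K).restrictScalars ℚ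

theorem resK_eq_conjQ [IsGalois ℚ K] {j : Gal(AlgebraicClosure K/ℚ)}
    {φ : AlgebraicClosure K →+* ℂ} (hj : ComplexEmbedding.IsConj φ j) : resK j = conjQ K :=
  AlgEquiv.ext (resK_eq_complexConj hj)

theorem conjQ_comm (δ : Gal(K/ℚ)) : δ * conjQ K = conjQ K * δ :=
  AlgEquiv.ext (complexConj_comm δ)

theorem conjQ_mul_self : conjQ K * conjQ K = 1 :=
  AlgEquiv.ext (IsCMField.complexConj_apply_apply K)

theorem galPrime_conjQ_asIdeal (Q : HeightOneSpectrum (𝓞 K)) :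
    (galPrime (conjQ K) Q).asIdeal = Q.asIdeal.map (IsCMField.ringOfIntegersComplexConj K) := by
  exact Ideal.comap_symm (I := Q.asIdeal)
    (IsCMField.ringOfIntegersComplexConj K).toRingEquiv

theorem aut_maximalRealSubfield_eq (σ : Gal(K/maximalRealSubfield K)) :
    σ = 1 ∨ σ = IsCMField.complexConj K := by
  have h : Nat.card Gal(K/maximalRealSubfield K) = 2 :=
    (Algebra.IsQuadraticExtension.finrank_eq_two (maximalRealSubfield K) K) ▸
      IsGalois.card_aut_eq_finrank (maximalRealSubfield K) K
  rw [Nat.card_eq_two_iff' 1] at h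
  by_cases h1 : σ = 1
  · exact Or.inl h1
  · exact Or.inr (h.unique h1 (IsCMField.complexConj_ne_one K))

theorem galPrime_conjQ_under (Q : HeightOneSpectrum (𝓞 K)) :
    (galPrime (conjQ K) Q).asIdeal.under (𝓞 (maximalRealSubfield K)) =
      Q.asIdeal.under (𝓞 (maximalRealSubfield K)) := by
  ext x
  rw [Ideal.mem_comap, mem_galPrime, Ideal.mem_comap]
  have : (RingOfIntegers.mapRingEquiv (conjQ K).toRingEquiv).symm
      (algebraMap (𝓞 (maximalRealSubfield K)) (𝓞 K) x) = algebraMap _ _ x := by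
    rw [RingEquiv.symm_apply_eq]
    ext
    exact (IsCMField.complexConj_apply_eq_self K x).symm
  rw [this]

/-- `Gal(K/K⁺)` acts transitively on the primes above a given one, and it has only two elements. -/
theorem eq_or_eq_of_under_eq {Q Q' : HeightOneSpectrum (𝓞 K)}
    (h : Q.asIdeal.under (𝓞 (maximalRealSubfield K)) =
      Q'.asIdeal.under (𝓞 (maximalRealSubfield K))) : Q' = Q ∨ Q' = galPrime (conjQ K) Q := by
  have h1 : Q.asIdeal.LiesOver (Q.asIdeal.under (𝓞 (maximalRealSubfield K))) := ⟨rfl⟩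
  have h2 : Q'.asIdeal.LiesOver (Q.asIdeal.under (𝓞 (maximalRealSubfield K))) := ⟨h⟩
  obtain ⟨σ, hσ⟩ := Ideal.exists_smul_eq_of_isGaloisGroup
    (Q.asIdeal.under (𝓞 (maximalRealSubfield K))) Q.asIdeal
    Q'.asIdeal Gal(K/maximalRealSubfield K)
  rcases aut_maximalRealSubfield_eq σ with rfl | rfl
  · left
    rw [one_smul] at hσ
    exact HeightOneSpectrum.ext hσ.symm
  · right
    refine HeightOneSpectrum.ext (hσ.symm.trans ?_)
    rw [galPrime_asIdeal]
    rfl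

theorem galPrime_conjQ_ne {p : ℕ} (hsplit : SplitAbove p K) {Q : HeightOneSpectrum (𝓞 K)}
    (hQ : (p : 𝓞 K) ∈ Q.asIdeal) : galPrime (conjQ K) Q ≠ Q := by
  intro h
  have h1 := hsplit (Q.asIdeal.under (𝓞 (maximalRealSubfield K))) (Q.isPrime.under _) (by
    rw [Ideal.mem_comap, map_natCast]; exact hQ)
  have h2 : (Q.asIdeal.under (𝓞 (maximalRealSubfield K))).primesOver (𝓞 K) ⊆ {Q.asIdeal} := by
    rintro I ⟨hI, hI'⟩
    have hI0 : I ≠ ⊥ := by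
      rintro rfl
      apply Q.ne_bot
      have := hI'.over
      rw [Ideal.under_bot] at this
      exact Ideal.eq_bot_of_comap_eq_bot this
    have := eq_or_eq_of_under_eq (Q := Q) (Q' := ⟨I, hI, hI0⟩) hI'.over
    rw [h, or_self] at this
    exact congrArg HeightOneSpectrum.asIdeal this
  have h3 := Set.ncard_le_ncard h2
  rw [h1, Set.ncard_singleton] at h3
  omega

/-! ### Representatives of the cosets of the decomposition group -/

theorem under_galPrime {δ : Gal(K/ℚ)} {τ : Gal(maximalRealSubfield K/ℚ)}
    (h : ∀ x : maximalRealSubfield K, δ (x : K) = (τ x : K)) (Q : HeightOneSpectrum (𝓞 K)) :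
    (galPrime δ Q).asIdeal.under (𝓞 (maximalRealSubfield K)) =
      τ • Q.asIdeal.under (𝓞 (maximalRealSubfield K)) := by
  ext x
  rw [Ideal.mem_comap, mem_galPrime, Ideal.mem_pointwise_smul_iff_inv_smul_mem, Ideal.mem_comap]
  have : (RingOfIntegers.mapRingEquiv δ.toRingEquiv).symm
      (algebraMap (𝓞 (maximalRealSubfield K)) (𝓞 K) x) = algebraMap _ _ (τ⁻¹ • x) := by
    rw [RingEquiv.symm_apply_eq]
    ext
    have := h (τ⁻¹ x)
    rw [← AlgEquiv.mul_apply, mul_inv_cancel, AlgEquiv.one_apply] at this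
    exact this.symm
  rw [this]

theorem exists_restrict (δ : Gal(K/ℚ)) : ∃ τ : Gal(maximalRealSubfield K/ℚ),
    ∀ x : maximalRealSubfield K, δ (x : K) = (τ x : K) := by
  -- `K⁺` is the fixed field of complex conjugation, which is central in `Gal(K/ℚ)`.
  have key : ∀ δ : Gal(K/ℚ), ∀ x ∈ maximalRealSubfield K, δ x ∈ maximalRealSubfield K := by
    intro δ x hx
    rw [← IsCMField.complexConj_eq_self_iff] at hx ⊢
    rw [← complexConj_comm, hx]
  refine ⟨AlgEquiv.ofRingEquiv (f :=
    { toFun x := ⟨δ x, key δ x x.2⟩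
      invFun x := ⟨δ⁻¹ x, key δ⁻¹ x x.2⟩
      left_inv x := Subtype.ext (δ.symm_apply_apply x)
      right_inv x := Subtype.ext (δ.apply_symm_apply x)
      map_mul' x y := Subtype.ext (map_mul δ (x : K) y)
      map_add' x y := Subtype.ext (map_add δ (x : K) y) }) fun q => ?_, fun x => rfl⟩
  exact map_ratCast _ q

variable {P : HeightOneSpectrum (𝓞 K)}
  {r : Gal(maximalRealSubfield K/ℚ) ⧸ decompPlus K P.asIdeal → Gal(K/ℚ)}

theorem IsRepresentatives.exists_eq_or_eq (hr : IsRepresentatives K P.asIdeal r) (δ : Gal(K/ℚ)) :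
    ∃ q, galPrime δ P = galPrime (r q) P ∨
      galPrime δ P = galPrime (conjQ K) (galPrime (r q) P) := by
  obtain ⟨τ, hτ⟩ := exists_restrict δ
  refine ⟨QuotientGroup.mk τ, eq_or_eq_of_under_eq ?_⟩
  obtain ⟨τ', hτ', h⟩ := hr (QuotientGroup.mk τ)
  rw [under_galPrime hτ, under_galPrime hτ']
  have := QuotientGroup.eq.1 h
  rw [decompPlus, MulAction.mem_stabilizer_iff, mul_smul, inv_smul_eq_iff] at this
  exact this.symm

theorem IsRepresentatives.eq_of_under_eq (hr : IsRepresentatives K P.asIdeal r)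
    {q q' : Gal(maximalRealSubfield K/ℚ) ⧸ decompPlus K P.asIdeal}
    (h : (galPrime (r q) P).asIdeal.under (𝓞 (maximalRealSubfield K)) =
      (galPrime (r q') P).asIdeal.under (𝓞 (maximalRealSubfield K))) : q = q' := by
  obtain ⟨τ, hτ, rfl⟩ := hr q
  obtain ⟨τ', hτ', rfl⟩ := hr q'
  rw [under_galPrime hτ, under_galPrime hτ'] at h
  refine QuotientGroup.eq.2 ?_
  rw [decompPlus, MulAction.mem_stabilizer_iff, mul_smul, inv_smul_eq_iff]
  exact h.symm

theorem IsRepresentatives.card_eq [IsGalois ℚ K] {p : ℕ} [Fact p.Prime]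
    (hr : IsRepresentatives K P.asIdeal r) (hP : (p : 𝓞 K) ∈ P.asIdeal) :
    Nat.card (Gal(maximalRealSubfield K/ℚ) ⧸ decompPlus K P.asIdeal) =
      (conjPairs p K).ncard := by
  rw [← Nat.card_coe_set_eq]
  refine Nat.card_congr (Equiv.ofBijective (fun q => ⟨{(galPrime (r q) P).asIdeal,
    (galPrime (r q) P).asIdeal.map (IsCMField.ringOfIntegersComplexConj K)},
    (galPrime (r q) P).asIdeal, (galPrime (r q) P).isPrime, natCast_mem_galPrime hP, rfl⟩)
    ⟨fun q q' h => ?_, ?_⟩)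
  · have h' : ({(galPrime (r q) P).asIdeal, _} : Set (Ideal (𝓞 K))) =
      {(galPrime (r q') P).asIdeal, _} := congrArg Subtype.val h
    have hmem : (galPrime (r q) P).asIdeal ∈ ({(galPrime (r q') P).asIdeal,
        (galPrime (r q') P).asIdeal.map (IsCMField.ringOfIntegersComplexConj K)} :
        Set (Ideal (𝓞 K))) := by
      rw [← h']
      exact Set.mem_insert _ _
    apply hr.eq_of_under_eq
    rcases hmem with hmem | hmem
    · rw [hmem]
    · rw [hmem, ← galPrime_conjQ_asIdeal, galPrime_conjQ_under]
  · rintro ⟨_, Q, hQ, hpQ, rfl⟩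
    have hQ0 : Q ≠ ⊥ := by
      rintro rfl
      rw [Ideal.mem_bot, Nat.cast_eq_zero] at hpQ
      exact (Fact.out : p.Prime).ne_zero hpQ
    obtain ⟨δ, hδ⟩ := exists_galPrime_eq hP (Q' := ⟨Q, hQ, hQ0⟩) hpQ
    obtain ⟨q, hq⟩ := hr.exists_eq_or_eq δ
    refine ⟨q, Subtype.ext ?_⟩
    rw [hδ] at hq
    change ({(galPrime (r q) P).asIdeal,
        (galPrime (r q) P).asIdeal.map (IsCMField.ringOfIntegersComplexConj K)} :
        Set (Ideal (𝓞 K))) = _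
    have hcc := fun v : HeightOneSpectrum (𝓞 K) => galPrime_mul (conjQ K) (conjQ K) v
    simp only [conjQ_mul_self, galPrime_one] at hcc
    rcases hq with hq | hq
    · rw [← hq]
    · have h1 : galPrime (r q) P = galPrime (conjQ K) ⟨Q, hQ, hQ0⟩ := by rw [hq, ← hcc]
      rw [← galPrime_conjQ_asIdeal, ← hq, h1, galPrime_conjQ_asIdeal, Set.pair_comm]

end Conj

section Layers

set_option linter.unusedSectionVars false

/-! ### Automorphisms of the layers -/

theorem exists_apply_eq_pow_of_pow_eq_one {E : Type*} [Field E] (g : E ≃+* E) {k : ℕ} (hk : k ≠ 0)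
    {x : E} (hx : x ^ k = 1) : ∃ a : ℕ, g x = x ^ a := by
  have : NeZero k := ⟨hk⟩
  obtain ⟨a, ha⟩ := map_rootsOfUnity_eq_pow_self g (rootsOfUnity.mkOfPowEq x hx)
  exact ⟨a, by simpa using ha⟩

variable {p : ℕ} {K : Type*} [Field K] [NumberField K] [Fact p.Prime] [IsGalois ℚ K]

/-- `K_n` is generated by `K` and roots of unity; on the latter automorphisms act by raising to
powers, and such maps commute. -/
theorem apply_comm_of_mem_layer {g h : Gal(AlgebraicClosure K/ℚ)}
    (hgh : resK g * resK h = resK h * resK g) {n : ℕ} {x : AlgebraicClosure K}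
    (hx : x ∈ layer p K n) : g (h x) = h (g x) := by
  induction hx using IntermediateField.adjoin_induction with
  | mem x hx =>
    have h0 : p ^ n ≠ 0 := pow_ne_zero _ (Fact.out : p.Prime).ne_zero
    obtain ⟨a, ha⟩ := exists_apply_eq_pow_of_pow_eq_one g.toRingEquiv h0 hx
    obtain ⟨b, hb⟩ := exists_apply_eq_pow_of_pow_eq_one h.toRingEquiv h0 hx
    change g x = _ at ha
    change h x = _ at hb
    rw [ha, hb, map_pow, map_pow, ha, hb, ← pow_mul, ← pow_mul, mul_comm]
  | algebraMap x =>
    rw [← algebraMap_resK, ← algebraMap_resK, ← algebraMap_resK, ← algebraMap_resK]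
    exact congrArg _ (DFunLike.congr_fun hgh x)
  | add x y _ _ hx hy => simp only [map_add, hx, hy]
  | inv x _ hx => simp only [map_inv₀, hx]
  | mul x y _ _ hx hy => simp only [map_mul, hx, hy]

theorem layerIntAut_comm {g h : Gal(AlgebraicClosure K/ℚ)}
    (hgh : resK g * resK h = resK h * resK g) (n : ℕ) (x : 𝓞 (layer p K n)) :
    layerIntAut p n g (layerIntAut p n h x) = layerIntAut p n h (layerIntAut p n g x) := by
  ext
  exact apply_comm_of_mem_layer hgh (x : layer p K n).2

theorem layerAut_comm {g h : Gal(AlgebraicClosure K/ℚ)}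
    (hgh : resK g * resK h = resK h * resK g) (n : ℕ) (x : layer p K n) :
    layerAut p K n g (layerAut p K n h x) = layerAut p K n h (layerAut p K n g x) :=
  Subtype.ext (apply_comm_of_mem_layer hgh x.2)

theorem exists_algebraMap_eq_of_fixed {z : AlgebraicClosure K}
    (hz : ∀ g : Gal(AlgebraicClosure K/ℚ), resK g = 1 → g z = z) :
    ∃ s : K, algebraMap K (AlgebraicClosure K) s = z := by
  have : z ∈ (⊥ : IntermediateField K (AlgebraicClosure K)) := by
    rw [← InfiniteGalois.fixedField_bot, IntermediateField.mem_fixedField_iff]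
    intro σ _
    refine hz (σ.restrictScalars ℚ) (resK_eq_iff.2 fun x => ?_)
    exact σ.commutes x
  exact IntermediateField.mem_bot.1 this

/-! ### Degrees of the layers -/

theorem exists_isPrimitiveRoot_layer (n : ℕ) : ∃ ζ : layer p K n, IsPrimitiveRoot ζ (p ^ n) := by
  have : NeZero ((p ^ n : ℕ) : AlgebraicClosure K) :=
    ⟨Nat.cast_ne_zero.2 (pow_ne_zero _ (Fact.out : p.Prime).ne_zero)⟩
  obtain ⟨ζ, hζ⟩ := HasEnoughRootsOfUnity.exists_primitiveRoot (AlgebraicClosure K) (p ^ n)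
  refine ⟨⟨ζ, IntermediateField.subset_adjoin _ _ hζ.pow_eq_one⟩, ?_⟩
  exact IsPrimitiveRoot.of_map_of_injective (f := (layer p K n).val) hζ
    (layer p K n).val.injective

/-- `K_n` contains `ℚ(ζ_{p^n})`. Keeping the factor `[K : ℚ]` avoids determining which `p`-power
roots of unity already lie in `K`. -/
theorem totient_dvd_finrank_layer (n : ℕ) :
    (p ^ n).totient ∣ Module.finrank ℚ K * Module.finrank K (layer p K n) := by
  obtain ⟨ζ, hζ⟩ := exists_isPrimitiveRoot_layer (p := p) (K := K) n
  have hpos : 0 < p ^ n := pow_pos (Fact.out : p.Prime).pos n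
  have h1 : Module.finrank ℚ (IntermediateField.adjoin ℚ {ζ}) = (p ^ n).totient := by
    rw [IntermediateField.adjoin.finrank (Algebra.IsIntegral.isIntegral ζ),
      ← Polynomial.cyclotomic_eq_minpoly_rat hζ hpos, Polynomial.natDegree_cyclotomic]
  have : Module.finrank ℚ K * Module.finrank K (layer p K n) = Module.finrank ℚ (layer p K n) :=
    Module.finrank_mul_finrank ℚ K (layer p K n)
  rw [this, ← h1]
  exact ⟨_, (Module.finrank_mul_finrank ℚ (IntermediateField.adjoin ℚ {ζ}) (layer p K n)).symm⟩

theorem pow_dvd_finrank_layer (n : ℕ) :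
    p ^ n ∣ Module.finrank ℚ K * Module.finrank K (layer p K (n + 1)) := by
  refine dvd_trans ?_ (totient_dvd_finrank_layer (n + 1))
  rw [Nat.totient_prime_pow_succ Fact.out]
  exact dvd_mul_right _ _

variable (p K) in
-- Otherwise every layer would equal `K`, and every power of `p` would divide `[K : ℚ]`. The `N`
-- obtained here does not depend on any level `n`, which is what bounds the loss in the descent.
theorem exists_apply_ne :
    ∃ (N : ℕ) (ζ : AlgebraicClosure K) (σ : Gal(AlgebraicClosure K/ℚ)),
      ζ ^ p ^ N = 1 ∧ resK σ = 1 ∧ σ ζ ≠ ζ := by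
  by_contra! hcon
  have hbot : ∀ n, layer p K n = ⊥ := by
    intro n
    rw [eq_bot_iff, layer, IntermediateField.adjoin_le_iff]
    intro ζ hζ
    obtain ⟨s, hs⟩ := exists_algebraMap_eq_of_fixed fun g hg => hcon n ζ g hζ hg
    exact IntermediateField.mem_bot.2 ⟨s, hs⟩
  have h1 : ∀ n, p ^ n ∣ Module.finrank ℚ K := by
    intro n
    have := pow_dvd_finrank_layer (p := p) (K := K) n
    rwa [hbot, IntermediateField.finrank_bot, mul_one] at this
  have hpos : 0 < Module.finrank ℚ K := Module.finrank_pos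
  have h2 := Nat.le_of_dvd hpos (h1 (Module.finrank ℚ K))
  have h3 := Nat.lt_pow_self (n := Module.finrank ℚ K) (Fact.out : p.Prime).one_lt
  omega

/-! ### Complex conjugation on the layers -/

variable [IsCMField K] {j : Gal(AlgebraicClosure K/ℚ)} {φ : AlgebraicClosure K →+* ℂ}

/-- `K_n` inherits the CM property: under every embedding, complex conjugation is inversion on roots
of unity and `complexConj` on `K`, so it agrees with `j` on generators. -/
theorem star_apply_layer (hj : ComplexEmbedding.IsConj φ j) {n : ℕ} (ψ : layer p K n →+* ℂ)
    (x : layer p K n) : star (ψ x) = ψ (layerAut p K n j x) := by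
  obtain ⟨x, hx⟩ := x
  induction hx using IntermediateField.adjoin_induction with
  | mem x hx =>
    have h0 : p ^ n ≠ 0 := pow_ne_zero _ (Fact.out : p.Prime).ne_zero
    have hnorm : ∀ z : ℂ, z ^ p ^ n = 1 → star z = z⁻¹ := fun z hz =>
      (Complex.inv_eq_conj (Complex.norm_eq_one_of_pow_eq_one hz h0)).symm
    have hx' : x ^ p ^ n = 1 := hx
    have hjx : j x = x⁻¹ := by
      apply φ.injective
      rw [hj.eq, map_inv₀]
      exact hnorm _ (by rw [← map_pow, hx', map_one])
    have hmem : x ∈ layer p K n := IntermediateField.subset_adjoin _ _ hx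
    have hx1 : (⟨x, hmem⟩ : layer p K n) ^ p ^ n = 1 := Subtype.ext hx'
    have h2 : layerAut p K n j ⟨x, hmem⟩ = (⟨x, hmem⟩ : layer p K n)⁻¹ := Subtype.ext hjx
    rw [h2, map_inv₀]
    exact hnorm _ (by rw [← map_pow, hx1, map_one])
  | algebraMap x =>
    have h2 : layerAut p K n j ⟨algebraMap K (AlgebraicClosure K) x, algebraMap_mem _ x⟩ =
        algebraMap K (layer p K n) (IsCMField.complexConj K x) := by
      apply Subtype.ext
      rw [← resK_eq_complexConj hj]
      exact (algebraMap_resK j x).symm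
    rw [h2]
    exact (IsCMField.complexEmbedding_complexConj K (ψ.comp (algebraMap K (layer p K n))) x).symm
  | add x y hx hy hx' hy' =>
    change star (ψ (⟨x, hx⟩ + ⟨y, hy⟩)) = ψ (layerAut p K n j (⟨x, hx⟩ + ⟨y, hy⟩))
    rw [map_add, star_add, hx', hy', map_add, map_add]
  | inv x hx hx' =>
    change star (ψ (⟨x, hx⟩⁻¹)) = ψ (layerAut p K n j (⟨x, hx⟩⁻¹))
    rw [map_inv₀, star_inv₀, hx', map_inv₀, map_inv₀]
  | mul x y hx hy hx' hy' =>
    change star (ψ (⟨x, hx⟩ * ⟨y, hy⟩)) = ψ (layerAut p K n j (⟨x, hx⟩ * ⟨y, hy⟩))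
    rw [map_mul, star_mul', hx', hy', map_mul, map_mul]

/-- By `star_apply_layer` the relation `u · ju = 1` says that `u` has absolute value `1` at every
infinite place. -/
theorem pow_torsionOrder_eq_one_of_mul_conj_eq_one (hj : ComplexEmbedding.IsConj φ j) {n : ℕ}
    (u : (𝓞 (layer p K n))ˣ) (hu : (u : 𝓞 (layer p K n)) * layerIntAut p n j u = 1) :
    u ^ Units.torsionOrder (layer p K n) = 1 := by
  rw [← mem_rootsOfUnity, Units.rootsOfUnity_eq_torsion, Units.mem_torsion]
  intro w
  rw [← InfinitePlace.norm_embedding_eq]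
  have h1 : w.embedding u * star (w.embedding u) = 1 := by
    rw [star_apply_layer hj, ← map_mul, ← map_one w.embedding]
    exact congrArg (fun z : 𝓞 (layer p K n) => w.embedding z) hu
  have h2 := congrArg norm h1
  rw [norm_mul, norm_star, norm_one] at h2
  nlinarith [norm_nonneg (w.embedding u)]

theorem layerIntAut_conj_conj (hj : ComplexEmbedding.IsConj φ j) {n : ℕ}
    (x : 𝓞 (layer p K n)) : layerIntAut p n j (layerIntAut p n j x) = x := by
  ext
  apply φ.injective
  change φ (j (j ((x : layer p K n) : AlgebraicClosure K))) = _
  rw [hj.eq, hj.eq, star_star]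

/-! ### Valuations of elements of `K` -/

/-- Write `(s) = Q ^ k · I` with `I` prime to `Q`; in `K_n` the first factor becomes the `k [K_n :
K]`-th power of the prime above `Q`, and `I` stays prime to it. -/
theorem finrank_dvd_idealVal (hram : TotallyRamifiedAbove p K) {Q : HeightOneSpectrum (𝓞 K)}
    (hQ : (p : 𝓞 K) ∈ Q.asIdeal) (n : ℕ) {s : 𝓞 K} (hs : s ≠ 0) :
    Module.finrank K (layer p K n) ∣ idealVal (primeAbove p K n Q)
      (Ideal.span {algebraMap (𝓞 K) (𝓞 (layer p K n)) s}) := by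
  have hI : Ideal.span {s} ≠ 0 := by simpa using hs
  obtain ⟨I, hI1, hI2⟩ := (FiniteMultiplicity.of_prime_left Q.prime hI).exists_eq_pow_mul_and_not_dvd
  rw [← Set.image_singleton, ← Ideal.map_span, hI1, Ideal.map_mul, Ideal.map_pow,
    hram.map_eq hQ (primeAbove_under p K n Q), ← pow_mul]
  have h0 : I.map (algebraMap (𝓞 K) (𝓞 (layer p K n))) ≠ ⊥ := by
    intro h
    rw [Ideal.map_eq_bot_iff_of_injective (FaithfulSMul.algebraMap_injective _ _)] at h
    exact hI2 (h ▸ dvd_zero _)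
  rw [idealVal_mul _ (pow_ne_zero _ (primeAbove p K n Q).ne_bot) h0, idealVal_pow, idealVal_self,
    idealVal_eq_zero_of_not_le]
  · rw [mul_one, add_zero]
    exact dvd_mul_right _ _
  · intro hle
    apply hI2
    rw [Ideal.dvd_iff_le, ← primeAbove_under p K n Q]
    exact Ideal.map_le_iff_le_comap.1 hle

end Layers

/-! ### Descent to `K`: the valuation of an element trivialising `J / jJ` -/

section Independence

set_option linter.unusedSectionVars false

variable {p : ℕ} {K : Type*} [Field K] [NumberField K] [Fact p.Prime] [IsGalois ℚ K]

theorem exists_pow_action {n N : ℕ} (hN : N ≤ n) (σ : Gal(AlgebraicClosure K/ℚ))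
    {ζ : AlgebraicClosure K} (hζ : ζ ^ p ^ N = 1) (hσ : σ ζ ≠ ζ) :
    ∃ e : ℕ, ¬ (p : ℤ) ^ N ∣ (e : ℤ) - 1 ∧
      ∀ w : layer p K n, w ^ Units.torsionOrder (layer p K n) = 1 →
        layerAut p K n σ w = w ^ e := by
  have hp0 : p ≠ 0 := (Fact.out : p.Prime).ne_zero
  -- A common multiple, so that a single exponent describes `σ` both on the torsion units and on
  -- `ζ`. The integer exponent is reduced mod `k` to get a natural number.
  let k := Units.torsionOrder (layer p K n) * p ^ N
  have hk : NeZero k := ⟨mul_ne_zero (Units.torsionOrder_ne_zero _) (pow_ne_zero _ hp0)⟩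
  obtain ⟨m, hm⟩ := MonoidHom.map_cyclic (restrictRootsOfUnity (layerAut p K n σ) k)
  have hpow : ∀ w : layer p K n, w ^ k = 1 → layerAut p K n σ w = w ^ (m % (k : ℤ)).toNat := by
    intro w hw
    have h := congrArg (fun u : rootsOfUnity k (layer p K n) => ((u : (layer p K n)ˣ) : layer p K n))
      (hm (rootsOfUnity.mkOfPowEq w hw))
    simp only [restrictRootsOfUnity_coe_apply, rootsOfUnity.val_mkOfPowEq_coe, Subgroup.coe_zpow,
      Units.val_zpow_eq_zpow_val] at h
    rw [h, ← zpow_natCast, Int.toNat_of_nonneg (Int.emod_nonneg _ (by exact_mod_cast hk.out))]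
    have hw0 : w ≠ 0 := by
      rintro rfl
      rw [zero_pow hk.out] at hw
      exact zero_ne_one hw
    conv_lhs => rw [← Int.emod_add_mul_ediv m k, zpow_add₀ hw0, zpow_mul, zpow_natCast, hw,
      one_zpow, mul_one]
  refine ⟨(m % (k : ℤ)).toNat, ?_, fun w hw => hpow w (by rw [pow_mul, hw, one_pow])⟩
  intro hdvd
  have hmem : ζ ∈ layer p K n := layer_mono p K hN (IntermediateField.subset_adjoin _ _ hζ)
  have hζ' : (⟨ζ, hmem⟩ : layer p K n) ^ p ^ N = 1 := Subtype.ext hζ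
  have h := hpow ⟨ζ, hmem⟩ (by
    rw [show k = p ^ N * _ from mul_comm _ _, pow_mul, hζ', one_pow])
  apply hσ
  have h1 : σ ζ = ζ ^ (m % (k : ℤ)).toNat := congrArg Subtype.val h
  obtain ⟨d, hd⟩ := hdvd
  have hζ0 : ζ ≠ 0 := by
    rintro rfl
    rw [zero_pow (pow_ne_zero _ hp0)] at hζ
    exact zero_ne_one hζ
  rw [h1, ← zpow_natCast, show (((m % (k : ℤ)).toNat : ℕ) : ℤ) = 1 + ((p ^ N : ℕ) : ℤ) * d by
    push_cast; linarith, zpow_add₀ hζ0, zpow_mul, zpow_natCast, hζ, one_zpow, zpow_one, mul_one]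

variable [IsCMField K] {j : Gal(AlgebraicClosure K/ℚ)} {φ : AlgebraicClosure K →+* ℂ}

theorem resK_comm_conj (hj : ComplexEmbedding.IsConj φ j) (g : Gal(AlgebraicClosure K/ℚ)) :
    resK g * resK j = resK j * resK g := by
  rw [resK_eq_conjQ hj, conjQ_comm]

/-- If `(α) J² = (j α) (j J)²` for an ideal `J` fixed by `Gal(K_n/K)`, then `α / j α` is fixed by
`Gal(K_n/K)` up to roots of unity. -/
theorem exists_unit_of_span_mul_eq (hj : ComplexEmbedding.IsConj φ j) {n : ℕ}
    {J J' : Ideal (𝓞 (layer p K n))} (hJ0 : J ≠ ⊥) (hJ0' : J' ≠ ⊥)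
    {α : 𝓞 (layer p K n)} (hα0 : α ≠ 0)
    (hα : Ideal.span {α} * J ^ 2 = Ideal.span {layerIntAut p n j α} * J' ^ 2)
    {g : Gal(AlgebraicClosure K/ℚ)}
    (hJ : J.map (layerIntAut p n g) = J) (hJ' : J'.map (layerIntAut p n g) = J') :
    ∃ u : (𝓞 (layer p K n))ˣ, u ^ Units.torsionOrder (layer p K n) = 1 ∧
      layerIntAut p n g α * layerIntAut p n j α =
        α * layerIntAut p n g (layerIntAut p n j α) * u := by
  have hcomm := layerIntAut_comm (p := p) (resK_comm_conj hj g) n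
  have hjj := layerIntAut_conj_conj (p := p) (K := K) (n := n) hj
  set e := layerIntAut p n j with he
  set G := layerIntAut p n g with hG
  have h1 : Ideal.span {G α} * J ^ 2 = Ideal.span {G (e α)} * J' ^ 2 := by
    have := congrArg (Ideal.map G) hα
    rw [Ideal.map_mul, Ideal.map_mul, Ideal.map_pow, Ideal.map_pow, hJ, hJ', Ideal.map_span,
      Ideal.map_span, Set.image_singleton, Set.image_singleton] at this
    exact this
  have h2 : Ideal.span {α * G (e α)} * (J ^ 2 * J' ^ 2) =
      Ideal.span {G α * e α} * (J ^ 2 * J' ^ 2) := by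
    rw [← Ideal.span_singleton_mul_span_singleton, ← Ideal.span_singleton_mul_span_singleton]
    calc Ideal.span {α} * Ideal.span {G (e α)} * (J ^ 2 * J' ^ 2)
        = (Ideal.span {α} * J ^ 2) * (Ideal.span {G (e α)} * J' ^ 2) := by ring
      _ = (Ideal.span {e α} * J' ^ 2) * (Ideal.span {G α} * J ^ 2) := by rw [hα, h1]
      _ = _ := by ring
  have h3 := mul_right_cancel₀ (mul_ne_zero (pow_ne_zero 2 hJ0) (pow_ne_zero 2 hJ0')) h2
  obtain ⟨u, hu⟩ := Ideal.span_singleton_eq_span_singleton.1 h3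
  refine ⟨u, pow_torsionOrder_eq_one_of_mul_conj_eq_one hj u ?_, hu.symm⟩
  -- Conjugation exchanges the two sides of `hu`, whence `u · ju = 1`.
  have h4 := congrArg e hu
  rw [map_mul, map_mul, map_mul, hjj, ← hcomm, hjj, ← hcomm] at h4
  have h5 : (α * G (e α) * (e α * G α)) * (u * e u) = (α * G (e α) * (e α * G α)) * 1 := by
    linear_combination (e α * G α * e u) * hu + (G α * e α) * h4
  refine mul_left_cancel₀ ?_ h5
  simp [hα0]

/-- The heart of the independence proof. The integer `e` of the conclusion is the exponent of `σ` on
roots of unity minus one, and the parenthesis times `2` is, up to sign, the valuation of `Y = α /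
jα`. -/
theorem finrank_dvd_of_mk0_eq (hj : ComplexEmbedding.IsConj φ j)
    (hram : TotallyRamifiedAbove p K) {n N : ℕ} (hN : N ≤ n) {σ : Gal(AlgebraicClosure K/ℚ)}
    {ζ : AlgebraicClosure K} (hζ : ζ ^ p ^ N = 1) (hσ1 : resK σ = 1) (hσ : σ ζ ≠ ζ)
    {J J' : Ideal (𝓞 (layer p K n))} (hJ0 : J ≠ ⊥) (hJ0' : J' ≠ ⊥)
    (hJ : ∀ g, resK g = 1 → J.map (layerIntAut p n g) = J)
    (hJ' : ∀ g, resK g = 1 → J'.map (layerIntAut p n g) = J')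
    (hjJ : J.map (layerIntAut p n j) = J') (hjJ' : J'.map (layerIntAut p n j) = J)
    (hcl : ClassGroup.mk0 ⟨J, mem_nonZeroDivisors_iff_ne_zero.2 hJ0⟩ =
      ClassGroup.mk0 ⟨J', mem_nonZeroDivisors_iff_ne_zero.2 hJ0'⟩) :
    ∃ e : ℤ, ¬ (p : ℤ) ^ N ∣ e ∧ ∀ Q : HeightOneSpectrum (𝓞 K), (p : 𝓞 K) ∈ Q.asIdeal →
      (Module.finrank K (layer p K n) : ℤ) ∣ e * (2 *
        ((idealVal (primeAbove p K n Q) J : ℤ) - idealVal (primeAbove p K n Q) J')) := by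
  obtain ⟨e, he, hpow⟩ := exists_pow_action hN σ hζ hσ
  refine ⟨e - 1, he, fun Q hQ => ?_⟩
  obtain ⟨x, y, hx, hy, hxy⟩ := ClassGroup.mk0_eq_mk0_iff.1 hcl
  have hjj := layerIntAut_conj_conj (p := p) (K := K) (n := n) hj
  -- a generator up to the square of `J`
  obtain ⟨α, hα0, hα⟩ : ∃ α : 𝓞 (layer p K n), α ≠ 0 ∧
      Ideal.span {α} * J ^ 2 = Ideal.span {layerIntAut p n j α} * J' ^ 2 := by
    refine ⟨x * layerIntAut p n j y, mul_ne_zero hx (by simpa using hy), ?_⟩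
    have hxy' := congrArg (Ideal.map (layerIntAut p n j)) hxy
    simp only [Ideal.map_mul, hjJ, hjJ', Ideal.map_span, Set.image_singleton] at hxy' hxy
    change Ideal.span {layerIntAut p n j x} * J' = Ideal.span {layerIntAut p n j y} * J at hxy'
    rw [map_mul, hjj, ← Ideal.span_singleton_mul_span_singleton,
      ← Ideal.span_singleton_mul_span_singleton]
    calc Ideal.span {x} * Ideal.span {layerIntAut p n j y} * J ^ 2
        = (Ideal.span {x} * J) * (Ideal.span {layerIntAut p n j y} * J) := by ring
      _ = (Ideal.span {y} * J') * (Ideal.span {layerIntAut p n j x} * J') := by rw [hxy, hxy']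
      _ = _ := by ring
  set α' := layerIntAut p n j α with hα'
  have hα0' : α' ≠ 0 := by simpa [hα'] using hα0
  let a : layer p K n := α
  let a' : layer p K n := α'
  have ha : a ≠ 0 := by simpa [a] using hα0
  have ha' : a' ≠ 0 := by simpa [a'] using hα0'
  let Y := a / a'
  have hY : Y ≠ 0 := div_ne_zero ha ha'
  -- the descent
  have hfix : ∀ g, resK g = 1 → layerAut p K n g (Y ^ e / layerAut p K n σ Y) =
      Y ^ e / layerAut p K n σ Y := by
    intro g hg
    obtain ⟨u, hu1, hu⟩ := exists_unit_of_span_mul_eq hj hJ0 hJ0' hα0 hα (hJ g hg) (hJ' g hg)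
    let w : layer p K n := (u : 𝓞 (layer p K n))
    have hw1 : w ^ Units.torsionOrder (layer p K n) = 1 := by
      have := congrArg (fun v : (𝓞 (layer p K n))ˣ => ((v : 𝓞 (layer p K n)) : layer p K n)) hu1
      simpa [w] using this
    have hw0 : w ≠ 0 := by simp [w]
    have hga : layerAut p K n g a * a' = a * layerAut p K n g a' * w :=
      congrArg (fun z : 𝓞 (layer p K n) => (z : layer p K n)) hu
    have hgY : layerAut p K n g Y = Y * w := by
      have hga' : layerAut p K n g a' ≠ 0 := by simpa using ha'
      simp only [Y, map_div₀]
      field_simp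
      linear_combination hga
    -- `g` and `σ` commute on `K_n`, so numerator and denominator both acquire the factor `w ^ e`,
    -- which cancels.
    rw [map_div₀, map_pow, layerAut_comm (by rw [hg, hσ1]) n Y, hgY, map_mul, hpow w hw1]
    have : layerAut p K n σ Y ≠ 0 := by simpa using hY
    field_simp
    rw [mul_pow, mul_comm]
  obtain ⟨s, hs⟩ := exists_algebraMap_eq_of_fixed
    (z := ((Y ^ e / layerAut p K n σ Y : layer p K n) : AlgebraicClosure K))
    fun g hg => congrArg Subtype.val (hfix g hg)
  obtain ⟨s₁, s₂, hs₂, rfl⟩ := IsFractionRing.div_surjective (A := 𝓞 K) s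
  have hs₂0 : s₂ ≠ 0 := nonZeroDivisors.ne_zero hs₂
  have hσY : layerAut p K n σ Y ≠ 0 := by simpa using hY
  have hs' : algebraMap K (layer p K n) (algebraMap (𝓞 K) K s₁ / algebraMap (𝓞 K) K s₂) =
      Y ^ e / layerAut p K n σ Y := Subtype.ext hs
  have hs₁0 : s₁ ≠ 0 := by
    rintro rfl
    rw [map_zero, zero_div, map_zero, eq_comm, div_eq_zero_iff] at hs'
    rcases hs' with h | h
    · exact pow_ne_zero e hY h
    · exact hσY h
  -- `Y ^ e / σY = s₁ / s₂` with denominators cleared, so that only valuations of integral ideals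
  -- are needed.
  have hint : α ^ e * layerIntAut p n σ α' * algebraMap (𝓞 K) (𝓞 (layer p K n)) s₂ =
      α' ^ e * layerIntAut p n σ α * algebraMap (𝓞 K) (𝓞 (layer p K n)) s₁ := by
    ext1
    change a ^ e * layerAut p K n σ a' * algebraMap K (layer p K n) (algebraMap (𝓞 K) K s₂) =
      a' ^ e * layerAut p K n σ a * algebraMap K (layer p K n) (algebraMap (𝓞 K) K s₁)
    have h1 : algebraMap K (layer p K n) (algebraMap (𝓞 K) K s₂) ≠ 0 := by simpa using hs₂0
    have h2 : layerAut p K n σ a ≠ 0 := by simpa using ha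
    have h3 : layerAut p K n σ a' ≠ 0 := by simpa using ha'
    simp only [Y, map_div₀, div_pow] at hs'
    field_simp at hs'
    linear_combination -hs'
  -- comparison of the valuations
  have hv := congrArg (fun z => idealVal (primeAbove p K n Q) (Ideal.span {z})) hint
  have hσα : Ideal.span {layerIntAut p n σ α} * J ^ 2 =
      Ideal.span {layerIntAut p n σ α'} * J' ^ 2 := by
    have := congrArg (Ideal.map (layerIntAut p n σ)) hα
    simp only [Ideal.map_mul, Ideal.map_pow, hJ σ hσ1, hJ' σ hσ1, Ideal.map_span,
      Set.image_singleton] at this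
    exact this
  have hspan : ∀ z : 𝓞 (layer p K n), z ≠ 0 → Ideal.span {z} ≠ ⊥ := fun z hz => by simpa using hz
  have hn1 := hspan _ hα0
  have hn2 := hspan _ hα0'
  have hn3 := hspan (layerIntAut p n σ α) (by simpa using hα0)
  have hn4 := hspan (layerIntAut p n σ α') (by simpa using hα0')
  have hn5 := hspan (algebraMap (𝓞 K) (𝓞 (layer p K n)) s₁) (by simpa using hs₁0)
  have hn6 := hspan (algebraMap (𝓞 K) (𝓞 (layer p K n)) s₂) (by simpa using hs₂0)
  simp only [← Ideal.span_singleton_mul_span_singleton, ← Ideal.span_singleton_pow] at hv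
  rw [idealVal_mul _ (mul_ne_zero (pow_ne_zero e hn1) hn4) hn6,
    idealVal_mul _ (pow_ne_zero e hn1) hn4, idealVal_pow,
    idealVal_mul _ (mul_ne_zero (pow_ne_zero e hn2) hn3) hn5,
    idealVal_mul _ (pow_ne_zero e hn2) hn3, idealVal_pow] at hv
  have hv1 := congrArg (idealVal (primeAbove p K n Q)) hα
  rw [idealVal_mul _ hn1 (pow_ne_zero 2 hJ0), idealVal_mul _ hn2 (pow_ne_zero 2 hJ0'),
    idealVal_pow, idealVal_pow] at hv1
  have hv2 := congrArg (idealVal (primeAbove p K n Q)) hσα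
  rw [idealVal_mul _ hn3 (pow_ne_zero 2 hJ0), idealVal_mul _ hn4 (pow_ne_zero 2 hJ0'),
    idealVal_pow, idealVal_pow] at hv2
  have hd1 := Int.natCast_dvd_natCast.2 (finrank_dvd_idealVal hram hQ n hs₁0)
  have hd2 := Int.natCast_dvd_natCast.2 (finrank_dvd_idealVal hram hQ n hs₂0)
  have hd := dvd_sub hd2 hd1
  zify at hv hv1 hv2
  refine (congrArg (_ ∣ ·) ?_).mpr hd
  linear_combination (e : ℤ) * hv1 - hv - hv2

end Independence

/-! ### Linear independence -/

theorem pow_dvd_of_pow_add_dvd_mul {q x y : ℤ} (hq : Prime q) {N m : ℕ} (hx : ¬ q ^ N ∣ x)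
    (h : q ^ (m + N) ∣ x * y) : q ^ m ∣ y := by
  induction N generalizing x with
  | zero => simp at hx
  | succ N ih =>
    by_cases hqx : q ∣ x
    · obtain ⟨x', rfl⟩ := hqx
      rw [pow_succ', mul_dvd_mul_iff_left hq.ne_zero] at hx
      rw [← add_assoc, pow_succ', mul_assoc, mul_dvd_mul_iff_left hq.ne_zero] at h
      exact ih hx h
    · exact (pow_dvd_pow q (by omega)).trans (hq.pow_dvd_of_dvd_mul_left _ hqx h)

section Independence

set_option linter.unusedSectionVars false

variable {p : ℕ} {K : Type*} [Field K] [NumberField K] [Fact p.Prime] [IsGalois ℚ K]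

theorem map_prod_primeAbove (hram : TotallyRamifiedAbove p K) {ι : Type*} [Fintype ι]
    {Q : ι → HeightOneSpectrum (𝓞 K)} (hQ : ∀ i, (p : 𝓞 K) ∈ (Q i).asIdeal) (a : ι → ℕ) (n : ℕ)
    (g : Gal(AlgebraicClosure K/ℚ)) :
    (∏ i, (primeAbove p K n (Q i)).asIdeal ^ a i).map (layerIntAut p n g) =
      ∏ i, (primeAbove p K n (galPrime (resK g) (Q i))).asIdeal ^ a i := by
  have := map_prod (Ideal.mapHom (layerIntAut p n g))
    (fun i => (primeAbove p K n (Q i)).asIdeal ^ a i) Finset.univ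
  simp only [Ideal.mapHom_apply] at this
  rw [this]
  refine Finset.prod_congr rfl fun i _ => ?_
  rw [Ideal.map_pow, map_primeAbove hram (hQ i)]

theorem prod_primeAbove_ne_bot {ι : Type*} [Fintype ι]
    (Q : ι → HeightOneSpectrum (𝓞 K)) (a : ι → ℕ) (n : ℕ) :
    ∏ i, (primeAbove p K n (Q i)).asIdeal ^ a i ≠ ⊥ :=
  Finset.prod_ne_zero_iff.2 fun i _ => pow_ne_zero _ (primeAbove p K n (Q i)).ne_bot

theorem toPPart_mk0_prod_primeAbove {ι : Type*} [Fintype ι]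
    (Q : ι → HeightOneSpectrum (𝓞 K)) (a : ι → ℕ) (n : ℕ) :
    toPPart p (ClassGroup.mk0 ⟨_, mem_nonZeroDivisors_iff_ne_zero.2
      (prod_primeAbove_ne_bot (p := p) Q a n)⟩) = ∑ i, a i • classSeq p (Q i) n := by
  have : (⟨_, mem_nonZeroDivisors_iff_ne_zero.2 (prod_primeAbove_ne_bot (p := p) Q a n)⟩ :
      (Ideal (𝓞 (layer p K n)))⁰) = ∏ i, (⟨(primeAbove p K n (Q i)).asIdeal,
        mem_nonZeroDivisors_iff_ne_zero.2 (primeAbove p K n (Q i)).ne_bot⟩ :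
        (Ideal (𝓞 (layer p K n)))⁰) ^ a i := by
    ext1
    simp
  rw [this, map_prod, toPPart_prod]
  refine Finset.sum_congr rfl fun i _ => ?_
  rw [map_pow, toPPart_pow]
  rfl

variable [IsCMField K] {j : Gal(AlgebraicClosure K/ℚ)} {φ : AlgebraicClosure K →+* ℂ}

/-- It suffices that each coefficient is divisible by every power of `p`; the level is chosen
according to the power wanted. -/
theorem linearIndependent_classSeq_sub (hram : TotallyRamifiedAbove p K)
    (hj : ComplexEmbedding.IsConj φ j) {ι : Type*} [Fintype ι]
    {Q : ι → HeightOneSpectrum (𝓞 K)} (hQ : ∀ i, (p : 𝓞 K) ∈ (Q i).asIdeal)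
    (hinj : Function.Injective Q) (hne : ∀ i k, galPrime (conjQ K) (Q k) ≠ Q i) :
    LinearIndependent ℤ_[p] fun i => classSeq p (Q i) - classSeq p (galPrime (conjQ K) (Q i)) := by
  classical
  have hpp : p.Prime := Fact.out
  have hpZ : Prime (p : ℤ) := Nat.prime_iff_prime_int.1 hpp
  rw [Fintype.linearIndependent_iff]
  intro c hc i
  by_contra hci
  obtain ⟨m, hm⟩ := FiniteMultiplicity.of_prime_left PadicInt.prime_p hci
  apply hm
  generalize m + 1 = m
  obtain ⟨N, ζ, σ, hζ, hσ1, hσ⟩ := exists_apply_ne p K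
  obtain ⟨d, hd⟩ : ∃ d : ℕ, ¬ (p : ℤ) ^ d ∣ 2 * (Module.finrank ℚ K : ℤ) := by
    have hpos : 0 < Module.finrank ℚ K := Module.finrank_pos
    refine ⟨2 * Module.finrank ℚ K, fun h => ?_⟩
    have h2 := Nat.le_of_dvd (by omega) (show p ^ (2 * Module.finrank ℚ K) ∣
      2 * Module.finrank ℚ K by exact_mod_cast h)
    have h3 := Nat.lt_pow_self (n := 2 * Module.finrank ℚ K) hpp.one_lt
    omega
  -- Of the `m + N + d` powers of `p` in `[K : ℚ][K_n : K]`, at most `d` are lost to `2 [K : ℚ]` and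
  -- at most `N` to `e`, leaving `m`. The extra `1` is the index shift in `pow_dvd_finrank_layer`.
  set n := m + N + d + 1 with hn
  obtain ⟨M, hM⟩ := exists_pow_smul_An_eq_zero (p := p) (K := K) n
  -- Precision `M` makes the error vanish in `A_n`; precision `m` lets divisibility of `a i` pass
  -- back to `c i`.
  let a : ι → ℕ := fun i => (c i).appr (M + m)
  have ha : ∀ i, ∃ w, c i = a i + (p : ℤ_[p]) ^ (M + m) * w := fun i => by
    obtain ⟨w, hw⟩ := Ideal.mem_span_singleton.1 (PadicInt.appr_spec (M + m) (c i))
    exact ⟨w, by rw [← hw]; ring⟩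
  let Q' : ι → HeightOneSpectrum (𝓞 K) := fun i => galPrime (conjQ K) (Q i)
  have hQ' : ∀ i, (p : 𝓞 K) ∈ (Q' i).asIdeal := fun i => natCast_mem_galPrime (hQ i)
  have hsum : ∑ i, a i • classSeq p (Q i) n = ∑ i, a i • classSeq p (Q' i) n := by
    have h := congrFun hc n
    rw [Finset.sum_apply] at h
    rw [← sub_eq_zero, ← Finset.sum_sub_distrib, ← Pi.zero_apply (M := fun n => An p K n) n, ← h]
    refine Finset.sum_congr rfl fun i _ => ?_
    obtain ⟨w, hw⟩ := ha i
    rw [Pi.smul_apply, Pi.sub_apply, hw, pow_add, mul_assoc, add_smul, mul_smul, hM, add_zero,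
      Nat.cast_smul_eq_nsmul, smul_sub]
  rw [← toPPart_mk0_prod_primeAbove, ← toPPart_mk0_prod_primeAbove] at hsum
  obtain ⟨t, ht, hcl⟩ : ∃ t : ℕ, ¬ p ∣ t ∧ ClassGroup.mk0 ⟨_, mem_nonZeroDivisors_iff_ne_zero.2
      (prod_primeAbove_ne_bot (p := p) Q (fun i => a i * t) n)⟩ = ClassGroup.mk0 ⟨_,
      mem_nonZeroDivisors_iff_ne_zero.2
      (prod_primeAbove_ne_bot (p := p) Q' (fun i => a i * t) n)⟩ := by
    generalize hx : ClassGroup.mk0 (⟨_, mem_nonZeroDivisors_iff_ne_zero.2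
      (prod_primeAbove_ne_bot (p := p) Q a n)⟩ : (Ideal (𝓞 (layer p K n)))⁰) = x at hsum
    generalize hy : ClassGroup.mk0 (⟨_, mem_nonZeroDivisors_iff_ne_zero.2
      (prod_primeAbove_ne_bot (p := p) Q' a n)⟩ : (Ideal (𝓞 (layer p K n)))⁰) = y at hsum
    have hxy : toPPart p (x / y) = 0 := by
      have := toPPart_mul p (x / y) y
      rw [div_mul_cancel, hsum] at this
      simpa using this
    obtain ⟨t, ht, h1⟩ := exists_pow_eq_one_of_toPPart_eq_zero p hxy
    refine ⟨t, ht, ?_⟩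
    rw [div_pow, div_eq_one, ← hx, ← hy, ← map_pow, ← map_pow] at h1
    convert h1 using 3 <;> simp [← Finset.prod_pow, pow_mul]
  have hcQ : ∀ v : HeightOneSpectrum (𝓞 K), galPrime (conjQ K) (galPrime (conjQ K) v) = v :=
    fun v => by rw [← galPrime_mul, conjQ_mul_self, galPrime_one]
  obtain ⟨e, he, hdvd⟩ := finrank_dvd_of_mk0_eq hj hram (n := n) (by omega) hζ hσ1 hσ
    (prod_primeAbove_ne_bot (p := p) Q (fun i => a i * t) n)
    (prod_primeAbove_ne_bot (p := p) Q' (fun i => a i * t) n)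
    (fun g hg => by simp only [map_prod_primeAbove hram hQ, hg, galPrime_one])
    (fun g hg => by simp only [map_prod_primeAbove hram hQ', hg, galPrime_one])
    (by simp only [map_prod_primeAbove hram hQ, resK_eq_conjQ hj, Q'])
    (by simp only [map_prod_primeAbove hram hQ', resK_eq_conjQ hj, Q', hcQ]) hcl
  have hval : idealVal (primeAbove p K n (Q i))
      (∏ k, (primeAbove p K n (Q k)).asIdeal ^ (a k * t)) = a i * t := by
    rw [idealVal_prod _ _ _ fun k _ => pow_ne_zero _ (primeAbove p K n (Q k)).ne_bot,
      Finset.sum_eq_single i]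
    · rw [idealVal_pow, idealVal_self, mul_one]
    · intro k _ hk
      rw [idealVal_pow, idealVal_of_ne, mul_zero]
      exact fun h => hk (hinj (primeAbove_injective n h)).symm
    · simp
  have hval' : idealVal (primeAbove p K n (Q i))
      (∏ k, (primeAbove p K n (Q' k)).asIdeal ^ (a k * t)) = 0 := by
    rw [idealVal_prod _ _ _ fun k _ => pow_ne_zero _ (primeAbove p K n (Q' k)).ne_bot]
    refine Finset.sum_eq_zero fun k _ => ?_
    rw [idealVal_pow, idealVal_of_ne, mul_zero]
    exact fun h => hne i k (primeAbove_injective n h).symm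
  have h1 := hdvd (Q i) (hQ i)
  rw [hval, hval', Nat.cast_zero, sub_zero] at h1
  have h2 : (p : ℤ) ^ (m + N + d) ∣ (2 * (Module.finrank ℚ K : ℤ)) * (e * (a i * t : ℕ)) := by
    have h3 : (p : ℤ) ^ (m + N + d) ∣
        (Module.finrank ℚ K : ℤ) * (Module.finrank K (layer p K n) : ℤ) := by
      exact_mod_cast pow_dvd_finrank_layer (p := p) (K := K) (m + N + d)
    refine h3.trans ((mul_dvd_mul_left _ h1).trans (dvd_of_eq ?_))
    ring
  have h3 := pow_dvd_of_pow_add_dvd_mul hpZ he (pow_dvd_of_pow_add_dvd_mul hpZ hd h2)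
  have h4 : p ^ m ∣ a i * t := by exact_mod_cast h3
  obtain ⟨k, hk⟩ := (Nat.Prime.prime hpp).pow_dvd_of_dvd_mul_right _ ht h4
  obtain ⟨w, hw⟩ := ha i
  rw [hw, hk, pow_add]
  refine dvd_add ⟨k, by push_cast; ring⟩ ⟨(p : ℤ_[p]) ^ M * w, by ring⟩

end Independence

/-! ### The module `B⁻` -/

section ModuleBminus

set_option linter.unusedSectionVars false

variable {p : ℕ} {K : Type*} [Field K] [NumberField K] [Fact p.Prime] [IsGalois ℚ K]
  [IsCMField K] {j : Gal(AlgebraicClosure K/ℚ)} {φ : AlgebraicClosure K →+* ℂ}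
  {P : HeightOneSpectrum (𝓞 K)}

theorem moduleBminus_le (hram : TotallyRamifiedAbove p K) (hP : (p : 𝓞 K) ∈ P.asIdeal) :
    moduleBminus p K j ≤ moduleB p K := by
  rintro _ ⟨y, hy, rfl⟩
  exact sub_mem hy (galAct_mem_moduleB hram hP j hy)

theorem galAct_mem_moduleBminus (hram : TotallyRamifiedAbove p K)
    (hj : ComplexEmbedding.IsConj φ j) (hP : (p : 𝓞 K) ∈ P.asIdeal)
    (g : Gal(AlgebraicClosure K/ℚ)) {y : ∀ n, An p K n} (hy : y ∈ moduleBminus p K j) :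
    galAct p K g y ∈ moduleBminus p K j := by
  obtain ⟨y, hy, rfl⟩ := hy
  refine ⟨galAct p K g y, galAct_mem_moduleB hram hP g hy, ?_⟩
  simp only [LinearMap.sub_apply, LinearMap.id_apply, map_sub]
  rw [← galAct_mul hram hP j g hy, ← galAct_mul hram hP g j hy,
    galAct_congr (g := g * j) (h := j * g) hram hP (by rw [map_mul, map_mul, resK_comm_conj hj]) hy]

/-- The action of `Gal(K/ℚ)` on `B⁻`. -/
def rhoBminus (hram : TotallyRamifiedAbove p K) (hj : ComplexEmbedding.IsConj φ j)
    (hP : (p : 𝓞 K) ∈ P.asIdeal) :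
    Representation ℤ_[p] Gal(K/ℚ) (moduleBminus p K j) where
  -- An arbitrary lift of `δ`; by `galAct_congr` the choice does not matter on `B`.
  toFun δ := (galAct p K (resK_surjective δ).choose).restrict
    fun _ hy => galAct_mem_moduleBminus hram hj hP _ hy
  map_one' := by
    ext1 y
    apply Subtype.ext
    have hy := moduleBminus_le hram hP y.2
    change galAct p K _ (y : ∀ n, An p K n) = y
    refine (galAct_congr hram hP ?_ hy).trans (galAct_one hram hP hy)
    rw [(resK_surjective 1).choose_spec, map_one]
  map_mul' δ ε := by
    ext1 y
    apply Subtype.ext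
    have hy := moduleBminus_le hram hP y.2
    change galAct p K _ (y : ∀ n, An p K n) = galAct p K _ (galAct p K _ y)
    refine (galAct_congr hram hP ?_ hy).trans (galAct_mul hram hP _ _ hy)
    rw [map_mul, (resK_surjective _).choose_spec, (resK_surjective _).choose_spec,
      (resK_surjective _).choose_spec]

theorem rhoBminus_apply (hram : TotallyRamifiedAbove p K) (hj : ComplexEmbedding.IsConj φ j)
    (hP : (p : 𝓞 K) ∈ P.asIdeal) {g : Gal(AlgebraicClosure K/ℚ)} {δ : Gal(K/ℚ)}
    (h : resK g = δ) (y : moduleBminus p K j) :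
    (rhoBminus hram hj hP δ y : ∀ n, An p K n) = galAct p K g y :=
  galAct_congr hram hP ((resK_surjective δ).choose_spec.trans h.symm) (moduleBminus_le hram hP y.2)

theorem seqB_eq (hram : TotallyRamifiedAbove p K) (hj : ComplexEmbedding.IsConj φ j)
    (hP : (p : 𝓞 K) ∈ P.asIdeal) {Pn : ∀ n, HeightOneSpectrum (𝓞 (layer p K n))}
    (hPn : ∀ n, (Pn n).asIdeal.under (𝓞 K) = P.asIdeal) :
    seqB p K j Pn = classSeq p P - classSeq p (galPrime (conjQ K) P) := by
  have : (fun n => primeClass p K n (Pn n)) = classSeq p P := by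
    funext n
    rw [hram.eq_primeAbove hP (hPn n)]
    rfl
  rw [seqB, this, galAct_classSeq hram hP, resK_eq_conjQ hj]

theorem galAct_classSeq_sub (hram : TotallyRamifiedAbove p K) (hP : (p : 𝓞 K) ∈ P.asIdeal)
    {g : Gal(AlgebraicClosure K/ℚ)} {δ : Gal(K/ℚ)} (h : resK g = δ) :
    galAct p K g (classSeq p P - classSeq p (galPrime (conjQ K) P)) =
      classSeq p (galPrime δ P) - classSeq p (galPrime (conjQ K) (galPrime δ P)) := by
  rw [map_sub, galAct_classSeq hram hP, galAct_classSeq hram (natCast_mem_galPrime hP), h,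
    ← galPrime_mul, ← galPrime_mul, conjQ_comm]

theorem moduleBminus_eq_span (hram : TotallyRamifiedAbove p K)
    (hj : ComplexEmbedding.IsConj φ j) (hP : (p : 𝓞 K) ∈ P.asIdeal)
    {r : Gal(maximalRealSubfield K/ℚ) ⧸ decompPlus K P.asIdeal → Gal(K/ℚ)}
    (hr : IsRepresentatives K P.asIdeal r) :
    moduleBminus p K j = Submodule.span ℤ_[p] (Set.range fun q =>
      classSeq p (galPrime (r q) P) - classSeq p (galPrime (conjQ K) (galPrime (r q) P))) := by
  have hmap : ∀ δ : Gal(K/ℚ), (LinearMap.id - galAct p K j : (∀ n, An p K n) →ₗ[ℤ_[p]] _)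
      (classSeq p (galPrime δ P)) =
      classSeq p (galPrime δ P) - classSeq p (galPrime (conjQ K) (galPrime δ P)) := fun δ => by
    rw [LinearMap.sub_apply, LinearMap.id_apply, galAct_classSeq hram (natCast_mem_galPrime hP),
      resK_eq_conjQ hj]
  rw [moduleBminus, moduleB_eq_span hram hP, Submodule.map_span]
  apply le_antisymm
  · refine Submodule.span_le.2 ?_
    rintro _ ⟨_, ⟨δ, rfl⟩, rfl⟩
    simp only [hmap]
    obtain ⟨q, hq | hq⟩ := hr.exists_eq_or_eq δ
    · rw [hq]
      exact Submodule.subset_span ⟨q, rfl⟩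
    -- Here `δP` is the conjugate of a representative, so its generator is minus that of the
    -- representative.
    · rw [hq, ← galPrime_mul (conjQ K) (conjQ K), conjQ_mul_self, galPrime_one, ← neg_sub]
      exact neg_mem (Submodule.subset_span ⟨q, rfl⟩)
  · refine Submodule.span_le.2 ?_
    rintro _ ⟨q, rfl⟩
    exact Submodule.subset_span ⟨_, ⟨r q, rfl⟩, hmap (r q)⟩

end ModuleBminus

/-! ### Cyclicity over the group ring, and the main theorem -/

theorem span_monoidAlgebra_eq_top {k G V : Type*} [CommRing k] [Group G] [AddCommMonoid V]
    [Module k V] (ρ : Representation k G V) (b : V) {ι : Type*} (r : ι → G)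
    (h : Submodule.span k (Set.range fun i => ρ (r i) b) = ⊤) :
    Submodule.span (MonoidAlgebra k G) {ρ.asModuleEquiv.symm b} = ⊤ := by
  rw [eq_top_iff]
  intro y _
  obtain ⟨y, rfl⟩ := ρ.asModuleEquiv.symm.surjective y
  have hy : y ∈ Submodule.span k (Set.range fun i => ρ (r i) b) := h ▸ Submodule.mem_top
  induction hy using Submodule.span_induction with
  | mem y hy =>
    obtain ⟨i, rfl⟩ := hy
    rw [Representation.asModuleEquiv_symm_map_rho]
    exact Submodule.smul_mem _ _ (Submodule.mem_span_singleton_self _)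
  | zero => rw [map_zero]; exact zero_mem _
  | add x y _ _ hx hy => rw [map_add]; exact add_mem (hx trivial) (hy trivial)
  | smul a x _ hx =>
    rw [Representation.asModuleEquiv_symm_map_smul]
    exact Submodule.smul_mem _ _ (hx trivial)

end GrossKuzmin
end

theorem lemma4 (p : ℕ) [Fact p.Prime] (hp : p ≠ 2)
    (K : Type*) [Field K] [NumberField K] [IsGalois ℚ K] [IsCMField K]
    (hζ : ∃ ζ : K, IsPrimitiveRoot ζ p)
    (hram : GrossKuzmin.TotallyRamifiedAbove p K)
    (hsplit : GrossKuzmin.SplitAbove p K)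
    -- a complex conjugation of the algebraic closure of `K`
    (j : Gal(AlgebraicClosure K/ℚ)) (φ : AlgebraicClosure K →+* ℂ)
    (hj : ComplexEmbedding.IsConj φ j)
    -- a prime `℘` of `K` above `p`, and the primes `℘_n` of `K_n` above it
    (P : HeightOneSpectrum (𝓞 K)) (hP : (p : 𝓞 K) ∈ P.asIdeal)
    (Pn : ∀ n, HeightOneSpectrum (𝓞 (GrossKuzmin.layer p K n)))
    (hPn : ∀ n, (Pn n).asIdeal.under (𝓞 K) = P.asIdeal)
    -- representatives `C⁺` of `Δ⁺/D(℘⁺)`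
    (r : Gal(maximalRealSubfield K/ℚ) ⧸ GrossKuzmin.decompPlus K P.asIdeal → Gal(K/ℚ))
    (hr : GrossKuzmin.IsRepresentatives K P.asIdeal r) :
    -- the Galois action on ideal classes induces an action of `Δ = Gal(K/ℚ)` on `B⁻`
    ∃ ρ : Representation ℤ_[p] Gal(K/ℚ) (GrossKuzmin.moduleBminus p K j),
      (∀ (g : Gal(AlgebraicClosure K/ℚ)) (δ : Gal(K/ℚ)),
        (∀ x : K, g (algebraMap K (AlgebraicClosure K) x) =
          algebraMap K (AlgebraicClosure K) (δ x)) →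
        ∀ y, (ρ δ y : ∀ n, GrossKuzmin.An p K n) = GrossKuzmin.galAct p K g y) ∧
      -- `b` lies in `B⁻`
      ∃ b : GrossKuzmin.moduleBminus p K j,
        (b : ∀ n, GrossKuzmin.An p K n) = GrossKuzmin.seqB p K j Pn ∧
        -- `B⁻` is spanned over `ℤ_p` by the `ν b`, `ν ∈ C⁺`, and these are independent
        Submodule.span ℤ_[p] (Set.range fun q => ρ (r q) b) = ⊤ ∧
        LinearIndependent ℤ_[p] (fun q => ρ (r q) b) ∧
        -- `B⁻ = ℤ_p[Δ] b`
        Submodule.span (MonoidAlgebra ℤ_[p] Gal(K/ℚ)) {ρ.asModuleEquiv.symm b} = ⊤ ∧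
        -- `B⁻` is free of rank `s = |C⁺|`, the number of pairs of conjugate primes above `p`
        Module.Finite ℤ_[p] (GrossKuzmin.moduleBminus p K j) ∧
        Module.Free ℤ_[p] (GrossKuzmin.moduleBminus p K j) ∧
        Module.finrank ℤ_[p] (GrossKuzmin.moduleBminus p K j) =
          Nat.card (Gal(maximalRealSubfield K/ℚ) ⧸ GrossKuzmin.decompPlus K P.asIdeal) ∧
        Nat.card (Gal(maximalRealSubfield K/ℚ) ⧸ GrossKuzmin.decompPlus K P.asIdeal) =
          (GrossKuzmin.conjPairs p K).ncard := by

  have hP' := fun q => GrossKuzmin.natCast_mem_galPrime (δ := r q) hP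
  have hmem : GrossKuzmin.seqB p K j Pn ∈ GrossKuzmin.moduleBminus p K j := by
    rw [GrossKuzmin.seqB_eq hram hj hP hPn]
    refine ⟨_, GrossKuzmin.classSeq_mem_moduleB hram hP, ?_⟩
    rw [LinearMap.sub_apply, LinearMap.id_apply, GrossKuzmin.galAct_classSeq hram hP,
      GrossKuzmin.resK_eq_conjQ hj]
  have hcoe : ∀ δ, (GrossKuzmin.rhoBminus hram hj hP δ ⟨_, hmem⟩ : ∀ n, GrossKuzmin.An p K n) =
      GrossKuzmin.classSeq p (GrossKuzmin.galPrime δ P) - GrossKuzmin.classSeq p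
        (GrossKuzmin.galPrime (GrossKuzmin.conjQ K) (GrossKuzmin.galPrime δ P)) := by
    intro δ
    obtain ⟨g, hg⟩ := GrossKuzmin.resK_surjective δ
    rw [GrossKuzmin.rhoBminus_apply hram hj hP hg, ← GrossKuzmin.galAct_classSeq_sub hram hP hg,
      ← GrossKuzmin.seqB_eq hram hj hP hPn]
  have hspan : Submodule.span ℤ_[p]
      (Set.range fun q => GrossKuzmin.rhoBminus hram hj hP (r q) ⟨_, hmem⟩) = ⊤ := by
    apply Submodule.map_injective_of_injective (Submodule.subtype_injective _)
    rw [Submodule.map_span, ← Set.range_comp, Submodule.map_top, Submodule.range_subtype]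
    refine Eq.trans ?_ (GrossKuzmin.moduleBminus_eq_span hram hj hP hr).symm
    congr 2
    funext q
    exact hcoe (r q)
  have hli : LinearIndependent ℤ_[p]
      (fun q => GrossKuzmin.rhoBminus hram hj hP (r q) ⟨_, hmem⟩) := by
    have := Fintype.ofFinite (Gal(maximalRealSubfield K/ℚ) ⧸ GrossKuzmin.decompPlus K P.asIdeal)
    apply LinearIndependent.of_comp (Submodule.subtype _)
    -- No chosen prime is conjugate to a chosen one: conjugate primes lie over the same prime of
    -- `K⁺`, so they would come from the same coset, and a prime equal to its own conjugate
    -- contradicts the splitting hypothesis.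
    have h := GrossKuzmin.linearIndependent_classSeq_sub hram hj hP'
      (fun q q' h => hr.eq_of_under_eq (by rw [h])) (fun q q' h => by
        have hq : q = q' := hr.eq_of_under_eq (by rw [← h, GrossKuzmin.galPrime_conjQ_under])
        subst hq
        exact GrossKuzmin.galPrime_conjQ_ne hsplit (hP' q) h)
    convert h using 1
    funext q
    exact hcoe (r q)
  have hcyc := GrossKuzmin.span_monoidAlgebra_eq_top (GrossKuzmin.rhoBminus hram hj hP)
    (⟨_, hmem⟩ : GrossKuzmin.moduleBminus p K j) r hspan
  let B := Module.Basis.mk hli hspan.ge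
  exact ⟨GrossKuzmin.rhoBminus hram hj hP,
    fun g δ h y => GrossKuzmin.rhoBminus_apply hram hj hP (GrossKuzmin.resK_eq_iff.2 h) y,
    ⟨_, hmem⟩, rfl, hspan, hli, hcyc,
    Module.Finite.of_basis B, Module.Free.of_basis B, Module.finrank_eq_nat_card_basis B,
    hr.card_eq hP⟩
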